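/- Let $R$ be an arbitrary commutative ring. For $v,w\in R^n$ let $v\cdot w^{\intercal}=\sum_i v_iw_i$, and let $H(R^n)=R^n\oplus (R^n)^*$ be the hyperbolic space with the quadratic form $q(v,w)=v\cdot w^{\intercal}$. Notation. - $Um_n(R)$ is the set of unimodular rows, i.e. of those $v\in R^n$ with $v\cdot w^{\intercal}=1$ for some $w\in R^n$. The group $E_n(R)\subseteq SL_n(R)$, generated by the elementary matrices $1+\lambda e_{ij}$ ($i\ne j$, $\lambda\in R$), acts on it by $(v,g)\mapsto vg$. - $U_{2n-1}(R)=\{(v,w)\in H(R^n): q(v,w)=1\}$ is the unit sphere. - $Cl=Cl_0\oplus Cl_1$ is the Clifford algebra of $(H(R^n),q)$ (so $x^2=q(x)$ for $x\in H(R^n)$), and $*$ is its standard involution, the anti-automorphism that is $-1$ on $H(R^n)$. The Spin group is $$\mathrm{Spin}_{2n}(R)=\{x\in Cl_0 : xx^*=1,\ xH(R^n)x^{-1}=H(R^n)\};$$ it acts on $H(R^n)$, and on $U_{2n-1}(R)$, through $\pi(x):p\mapsto xpx^{-1}$. - $EO_{2n}(R)$ is the group generated by the matrices $I_{2n}+\lambda(e_{ij}-e_{\partial(j)\partial(i)})$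 with $1\le i\neq j\le 2n$, $\lambda\in R$, where $\partial$ is the permutation $(1\ \,n{+}1)\cdots(n\ \,2n)$; it acts on $H(R^n)=R^{2n}$ and on $U_{2n-1}(R)$. The elementary Spin group is $\mathrm{Epin}_{2n}(R)=\pi^{-1}(EO_{2n}(R))$. - $A_4(R)$ is the set of alternating $4\times 4$ matrices $M$ over $R$ (that is, $M^{\intercal}=-M$ with zero diagonal) with Pfaffian $m_{12}m_{34}-m_{13}m_{24}+m_{14}m_{23}=1$. The group $SL_4(R)$, and hence $E_4(R)$, acts on it by $(g,M)\mapsto gMg^{\intercal}$. - For $v=(a_1,a_2,a_3)$ and $w=(b_1,b_2,b_3)$, the vector $(v,w)\in H(R^3)$ is identified with its Suslin matrix $\mathcal S(v,w)$, and $V(v,w)=\beta\,\mathcal S(v,w)\,J\,\beta^{\intercal}$ is the Vaserstein matrix, where $$\mathcal S(v,w)=\begin{pmatrix} a_1&0&a_2&a_3\\ 0&a_1&-b_3&b_2\\ -b_2&a_3&b_1&0\\ -b_3&-a_2&0&b_1\end{pmatrix},\quad J=\begin{pmatrix}0&1&0&0\\-1&0&0&0\\0&0&0&-1\\0&0&1&0\end{pmatrix},\quad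 \beta=\begin{pmatrix}1&0&0&0\\0&-1&0&0\\0&0&0&1\\0&0&-1&0\end{pmatrix}.$$ For $(v,w)\in U_5(R)$ one has $V(v,w)\in A_4(R)$. **Theorem.** The assignment $(v,w)\mapsto V(v,w)$ induces a well-defined bijection $$\frac{U_5(R)}{\mathrm{Spin}_6(R)}\longleftrightarrow\frac{A_4(R)}{SL_4(R)}.$$ Moreover, the orbits of $EO_6(R)$ and of $\mathrm{Epin}_6(R)$ on $U_5(R)$ coincide, and there are well-defined bijections $$\frac{Um_3(R)}{E_3(R)}\longleftrightarrow\frac{U_5(R)}{EO_6(R)}=\frac{U_5(R)}{\mathrm{Epin}_6(R)}\longleftrightarrow\frac{A_4(R)}{E_4(R)},$$ which send the class of $v$ to the class of $(v,w)$ (that is, of $\mathcal S(v,w)$), and the class of $(v,w)$ to the class of $V(v,w)$, for every $(v,w)\in U_5(R)$. -/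

import Mathlib

namespace SpinVas

open Matrix

section Hyperbolic

variable (R : Type*) [CommRing R] (n : ℕ)

/-- The underlying module of the hyperbolic space `H(R^n) = R^n ⊕ (R^n)^*`. A vector `p` is the
pair `(v, w)` with `v i = p (Sum.inl i)` and `w i = p (Sum.inr i)`. -/
abbrev Hyp : Type _ := Fin n ⊕ Fin n → R

/-- The bilinear map `((v, w), (v', w')) ↦ v ⬝ w'`. -/
def hypBilin : LinearMap.BilinForm R (Hyp R n) :=
  LinearMap.mk₂ R (fun p p' => (fun i => p (Sum.inl i)) ⬝ᵥ (fun i => p' (Sum.inr i)))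
    (fun _ _ _ => add_dotProduct _ _ _) (fun _ _ _ => smul_dotProduct _ _ _)
    (fun _ _ _ => dotProduct_add _ _ _) (fun _ _ _ => dotProduct_smul _ _ _)

/-- The hyperbolic quadratic form `q(v, w) = v ⬝ w`. -/
def hypQ : QuadraticForm R (Hyp R n) := (hypBilin R n).toQuadraticMap

theorem hypQ_apply (p : Hyp R n) :
    hypQ R n p = (fun i => p (Sum.inl i)) ⬝ᵥ (fun i => p (Sum.inr i)) := rfl

/-- The Clifford algebra of the hyperbolic space. -/
abbrev Cl : Type _ := CliffordAlgebra (hypQ R n)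

/-- The inclusion of the hyperbolic space into its Clifford algebra. -/
abbrev incl : Hyp R n →ₗ[R] Cl R n := CliffordAlgebra.ι (hypQ R n)

theorem incl_injective : Function.Injective (incl R n) := by
  have h : (-(hypBilin R n)).toQuadraticMap = 0 - hypQ R n := by
    ext p
    simp [hypQ]
  intro x y hxy
  have h2 := congrArg (CliffordAlgebra.changeForm h) hxy
  rw [CliffordAlgebra.changeForm_ι, CliffordAlgebra.changeForm_ι] at h2
  exact (ExteriorAlgebra.ι_leftInverse (R := R) (M := Hyp R n)).injective h2

/-- The Spin group of the hyperbolic space: the `x` in the even Clifford algebra with `x x^* = 1`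
and `x H x⁻¹ = H`. Here `star` is the standard involution of the Clifford algebra, the
anti-automorphism that is `-1` on vectors. -/
def Spin : Subgroup (Cl R n)ˣ where
  carrier := {x | (x : Cl R n) ∈ CliffordAlgebra.even (hypQ R n) ∧
    (x : Cl R n) * star (x : Cl R n) = 1 ∧
    (fun y : Cl R n => (x : Cl R n) * y * ((x⁻¹ : (Cl R n)ˣ) : Cl R n)) ''
      Set.range (incl R n) = Set.range (incl R n)}
  one_mem' := by
    refine ⟨one_mem _, by simp, by simp⟩
  mul_mem' := by
    rintro a b ⟨ha1, ha2, ha3⟩ ⟨hb1, hb2, hb3⟩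
    refine ⟨by simpa using mul_mem ha1 hb1, ?_, ?_⟩
    · rw [Units.val_mul, star_mul, mul_assoc, ← mul_assoc (b : Cl R n), hb2, one_mul, ha2]
    · conv_rhs => rw [← ha3, ← hb3, Set.image_image]
      simp only [Units.val_mul, _root_.mul_inv_rev, mul_assoc]
  inv_mem' := by
    rintro a ⟨ha1, ha2, ha3⟩
    have hs : star (a : Cl R n) = ((a⁻¹ : (Cl R n)ˣ) : Cl R n) :=
      (Units.inv_eq_of_mul_eq_one_right ha2).symm
    refine ⟨?_, ?_, ?_⟩
    · rw [← hs, CliffordAlgebra.star_def]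
      exact (CliffordAlgebra.reverse_mem_evenOdd_iff (hypQ R n)).2
        ((CliffordAlgebra.involute_mem_evenOdd_iff (hypQ R n)).2 ha1)
    · rw [← hs, star_star, hs, Units.inv_mul]
    · conv_lhs => rw [← ha3, Set.image_image]
      simp [mul_assoc]

theorem spin_conj_mem (x : Spin R n) (p : Hyp R n) :
    ((x : (Cl R n)ˣ) : Cl R n) * incl R n p * (((x : (Cl R n)ˣ)⁻¹ : (Cl R n)ˣ) : Cl R n) ∈
      LinearMap.range (incl R n) := by
  have h : _ ∈ Set.range (incl R n) := x.2.2.2 ▸ Set.mem_image_of_mem _ (Set.mem_range_self p)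
  exact h

/-- The endomorphism `p ↦ x p x⁻¹` of `H(R^n)` given by an element `x` of the Spin group. -/
noncomputable def conjEnd (x : Spin R n) : Module.End R (Hyp R n) :=
  (LinearEquiv.ofInjective (incl R n) (incl_injective R n)).symm.toLinearMap ∘ₗ
    ((LinearMap.mulLeft R ((x : (Cl R n)ˣ) : Cl R n) ∘ₗ
      LinearMap.mulRight R (((x : (Cl R n)ˣ)⁻¹ : (Cl R n)ˣ) : Cl R n) ∘ₗ
        incl R n).codRestrict (LinearMap.range (incl R n)) (fun p => by
          simpa [mul_assoc] using spin_conj_mem R n x p))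

theorem incl_conjEnd (x : Spin R n) (p : Hyp R n) :
    incl R n (conjEnd R n x p) =
      ((x : (Cl R n)ˣ) : Cl R n) * incl R n p *
        (((x : (Cl R n)ˣ)⁻¹ : (Cl R n)ˣ) : Cl R n) := by
  rw [conjEnd, LinearMap.comp_apply, LinearEquiv.coe_coe,
    ← LinearEquiv.ofInjective_apply (h := incl_injective R n), LinearEquiv.apply_symm_apply]
  simp [mul_assoc]

/-- The homomorphism `π` from the Spin group to the invertible matrices acting on
`H(R^n) = R^(2n)`, which sends `x` to the matrix of `p ↦ x p x⁻¹`. -/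
noncomputable def spinProj : Spin R n →* GL (Fin n ⊕ Fin n) R :=
  (Matrix.GeneralLinearGroup.toLin (n := Fin n ⊕ Fin n) (R := R)).symm.toMonoidHom.comp
    (MonoidHom.toHomUnits
      { toFun := conjEnd R n
        map_one' := by
          refine LinearMap.ext fun p => incl_injective R n ?_
          rw [incl_conjEnd]
          simp
        map_mul' := fun x y => by
          refine LinearMap.ext fun p => incl_injective R n ?_
          rw [incl_conjEnd, Module.End.mul_apply, incl_conjEnd, incl_conjEnd]
          simp [mul_assoc] })

theorem incl_spinProj (x : Spin R n) (p : Hyp R n) :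
    incl R n ((spinProj R n x : Matrix (Fin n ⊕ Fin n) (Fin n ⊕ Fin n) R) *ᵥ p) =
      ((x : (Cl R n)ˣ) : Cl R n) * incl R n p *
        (((x : (Cl R n)ˣ)⁻¹ : (Cl R n)ˣ) : Cl R n) := by
  rw [← incl_conjEnd]
  congr 1
  change Matrix.toLin' (LinearMap.toMatrix' (conjEnd R n x)) p = _
  rw [Matrix.toLin'_toMatrix']

/-- The elementary orthogonal group `EO_{2n}(R)`, generated by the matrices
`1 + c (e_{ij} - e_{∂(j)∂(i)})`, `i ≠ j`, where `∂` interchanges `k` and `n + k`. -/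
def EO : Subgroup (GL (Fin n ⊕ Fin n) R) :=
  Subgroup.closure {g | ∃ i j : Fin n ⊕ Fin n, i ≠ j ∧ ∃ c : R,
    (g : Matrix (Fin n ⊕ Fin n) (Fin n ⊕ Fin n) R) =
      1 + c • (Matrix.single i j 1 - Matrix.single j.swap i.swap 1)}

/-- The elementary Spin group `Epin_{2n}(R)`, the inverse image of `EO_{2n}(R)` under `π`. -/
noncomputable def Epin : Subgroup (Spin R n) := (EO R n).comap (spinProj R n)

/-- The elementary linear group `E_n(R)`, generated by the matrices `1 + c e_{ij}`, `i ≠ j`. -/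
def E : Subgroup (SpecialLinearGroup (Fin n) R) :=
  Subgroup.closure {g | ∃ i j : Fin n, i ≠ j ∧ ∃ c : R,
    (g : Matrix (Fin n) (Fin n) R) = Matrix.transvection i j c}

/-- The set `Um_n(R)` of unimodular rows of length `n`. -/
abbrev Um : Type _ := {v : Fin n → R // ∃ w : Fin n → R, v ⬝ᵥ w = 1}

/-- The unit sphere `U_{2n-1}(R)` in `H(R^n)`. -/
abbrev Sphere : Type _ := {p : Hyp R n // hypQ R n p = 1}

variable {R n}

/-- The first component `v` of a point `(v, w)` of the unit sphere, as a unimodular row. -/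
def Sphere.row (p : Sphere R n) : Um R n :=
  ⟨fun i => p.1 (Sum.inl i), fun i => p.1 (Sum.inr i), p.2⟩

/-- Unimodular rows up to the right action `(v, g) ↦ v g` of a subgroup of `SL_n(R)`. -/
def umOrbit (G : Subgroup (SpecialLinearGroup (Fin n) R)) : Setoid (Um R n) where
  r v v' := ∃ g ∈ G, v.1 ᵥ* (g : Matrix (Fin n) (Fin n) R) = v'.1
  iseqv := {
    refl := fun v => ⟨1, one_mem _, by simp⟩
    symm := by
      rintro v v' ⟨g, hg, h⟩
      refine ⟨g⁻¹, inv_mem hg, ?_⟩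
      have h1 : (g : Matrix (Fin n) (Fin n) R) *
          ((g⁻¹ : SpecialLinearGroup (Fin n) R) : Matrix (Fin n) (Fin n) R) = 1 :=
        congrArg Subtype.val (mul_inv_cancel g)
      rw [← h, Matrix.vecMul_vecMul, h1, Matrix.vecMul_one]
    trans := by
      rintro v v' v'' ⟨g, hg, h⟩ ⟨g', hg', h'⟩
      refine ⟨g * g', mul_mem hg hg', ?_⟩
      rw [← h', ← h, Matrix.vecMul_vecMul]
      rfl }

/-- Points of the unit sphere up to the action of a group of matrices on `H(R^n) = R^(2n)`. -/
def sphereOrbit (G : Subgroup (GL (Fin n ⊕ Fin n) R)) : Setoid (Sphere R n) where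
  r p p' := ∃ g ∈ G, (g : Matrix (Fin n ⊕ Fin n) (Fin n ⊕ Fin n) R) *ᵥ p.1 = p'.1
  iseqv := {
    refl := fun p => ⟨1, one_mem _, by simp⟩
    symm := by
      rintro p p' ⟨g, hg, h⟩
      refine ⟨g⁻¹, inv_mem hg, ?_⟩
      rw [← h, Matrix.mulVec_mulVec, ← Units.val_mul]
      simp
    trans := by
      rintro p p' p'' ⟨g, hg, h⟩ ⟨g', hg', h'⟩
      refine ⟨g' * g, mul_mem hg' hg, ?_⟩
      rw [← h', ← h, Matrix.mulVec_mulVec, Units.val_mul] }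

/-- Points of the unit sphere up to the action of a subgroup of the Spin group, through `π`. -/
def spinOrbit (G : Subgroup (Spin R n)) : Setoid (Sphere R n) where
  r p p' := ∃ x ∈ G,
    (spinProj R n x : Matrix (Fin n ⊕ Fin n) (Fin n ⊕ Fin n) R) *ᵥ p.1 = p'.1
  iseqv := {
    refl := fun p => ⟨1, one_mem _, by simp⟩
    symm := by
      rintro p p' ⟨g, hg, h⟩
      refine ⟨g⁻¹, inv_mem hg, ?_⟩
      rw [← h, Matrix.mulVec_mulVec, ← Units.val_mul, ← map_mul]
      simp
    trans := by
      rintro p p' p'' ⟨g, hg, h⟩ ⟨g', hg', h'⟩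
      refine ⟨g' * g, mul_mem hg' hg, ?_⟩
      rw [← h', ← h, Matrix.mulVec_mulVec, map_mul, Units.val_mul] }

end Hyperbolic

section Alternating

variable {R : Type*} [CommRing R]

/-- Alternating matrices: skew-symmetric with zero diagonal. -/
def IsAlternating {m : ℕ} (M : Matrix (Fin m) (Fin m) R) : Prop :=
  Mᵀ = -M ∧ ∀ i, M i i = 0

/-- The Pfaffian of a `4 × 4` alternating matrix. -/
def pf4 (M : Matrix (Fin 4) (Fin 4) R) : R :=
  M 0 1 * M 2 3 - M 0 2 * M 1 3 + M 0 3 * M 1 2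

theorem det_eq_pf4_sq (M : Matrix (Fin 4) (Fin 4) R) (h : IsAlternating M) :
    M.det = pf4 M ^ 2 := by
  have hs : ∀ i j, M j i = -M i j := fun i j => congrFun (congrFun h.1 i) j
  have h0 := h.2
  simp only [Matrix.det_succ_row_zero, Fin.sum_univ_succ, pf4]
  simp [Fin.succAbove, h0]
  rw [hs 0 1, hs 0 2, hs 0 3, hs 1 2, hs 1 3, hs 2 3]
  ring

variable (R) in
/-- The set `A_4(R)` of `4 × 4` alternating matrices with Pfaffian `1`. -/
abbrev A4 : Type _ := {M : Matrix (Fin 4) (Fin 4) R // IsAlternating M ∧ pf4 M = 1}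

/-- Elements of `A_4(R)` up to the action `(g, M) ↦ g M gᵀ` of a subgroup of `SL_4(R)`. -/
def altOrbit (G : Subgroup (SpecialLinearGroup (Fin 4) R)) : Setoid (A4 R) where
  r M M' := ∃ g ∈ G, (g : Matrix (Fin 4) (Fin 4) R) * M.1 *
    (g : Matrix (Fin 4) (Fin 4) R)ᵀ = M'.1
  iseqv := {
    refl := fun M => ⟨1, one_mem _, by simp⟩
    symm := by
      rintro M M' ⟨g, hg, h⟩
      refine ⟨g⁻¹, inv_mem hg, ?_⟩
      have h1 : ((g⁻¹ : SpecialLinearGroup (Fin 4) R) : Matrix (Fin 4) (Fin 4) R) *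
          (g : Matrix (Fin 4) (Fin 4) R) = 1 :=
        congrArg Subtype.val (inv_mul_cancel g)
      rw [← h, ← mul_assoc, ← mul_assoc, h1, one_mul, mul_assoc, ← Matrix.transpose_mul, h1,
        Matrix.transpose_one, mul_one]
    trans := by
      rintro M M' M'' ⟨g, hg, h⟩ ⟨g', hg', h'⟩
      refine ⟨g' * g, mul_mem hg' hg, ?_⟩
      have h1 : ((g' * g : SpecialLinearGroup (Fin 4) R) : Matrix (Fin 4) (Fin 4) R) =
          (g' : Matrix (Fin 4) (Fin 4) R) * (g : Matrix (Fin 4) (Fin 4) R) := rfl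
      rw [← h', ← h, h1, Matrix.transpose_mul]
      simp only [mul_assoc] }

/-- The Suslin matrix `S_1(v, w)` of `v = (a, a')` and `w = (b, b')`. -/
def suslin1 (a a' b b' : R) : Matrix (Fin 2) (Fin 2) R := !![a, a'; -b', b]

/-- The conjugate of the Suslin matrix `S_1(v, w)`. -/
def suslin1Bar (a a' b b' : R) : Matrix (Fin 2) (Fin 2) R := !![b, -a'; b', a]

/-- The Suslin matrix `S_2(v, w)` of a vector `(v, w)` of `H(R^3)`, written in four blocks. -/
def suslin2 (p : Hyp R 3) : Matrix (Fin 4) (Fin 4) R :=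
  Matrix.reindex (finSumFinEquiv (m := 2) (n := 2)) (finSumFinEquiv (m := 2) (n := 2))
    (Matrix.fromBlocks
      (p (Sum.inl 0) • (1 : Matrix (Fin 2) (Fin 2) R))
      (suslin1 (p (Sum.inl 1)) (p (Sum.inl 2)) (p (Sum.inr 1)) (p (Sum.inr 2)))
      (-suslin1Bar (p (Sum.inl 1)) (p (Sum.inl 2)) (p (Sum.inr 1)) (p (Sum.inr 2)))
      (p (Sum.inr 0) • (1 : Matrix (Fin 2) (Fin 2) R)))

theorem suslin2_eq (a₁ a₂ a₃ b₁ b₂ b₃ : R) :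
    suslin2 (Sum.elim ![a₁, a₂, a₃] ![b₁, b₂, b₃]) =
      !![a₁, 0, a₂, a₃; 0, a₁, -b₃, b₂; -b₂, a₃, b₁, 0; -b₃, -a₂, 0, b₁] := by
  ext i j
  fin_cases i <;> fin_cases j <;>
    simp [suslin2, suslin1, suslin1Bar, finSumFinEquiv, Fin.addCases]

variable (R) in
/-- The matrix `J_2`. -/
def J2 : Matrix (Fin 4) (Fin 4) R :=
  !![0, 1, 0, 0; -1, 0, 0, 0; 0, 0, 0, -1; 0, 0, 1, 0]

variable (R) in
/-- The matrix `β`. -/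
def betaMat : Matrix (Fin 4) (Fin 4) R :=
  !![1, 0, 0, 0; 0, -1, 0, 0; 0, 0, 0, 1; 0, 0, -1, 0]

/-- The Vaserstein matrix `V(v, w) = β S_2(v, w) J_2 βᵀ`. -/
def vasMatrix (p : Hyp R 3) : Matrix (Fin 4) (Fin 4) R :=
  betaMat R * suslin2 p * J2 R * (betaMat R)ᵀ

theorem vasMatrix_eq (a₁ a₂ a₃ b₁ b₂ b₃ : R) :
    vasMatrix (Sum.elim ![a₁, a₂, a₃] ![b₁, b₂, b₃]) =
      !![0, -a₁, -a₂, -a₃; a₁, 0, -b₃, b₂; a₂, b₃, 0, -b₁; a₃, -b₂, b₁, 0] := by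
  rw [vasMatrix, suslin2_eq]
  ext i j
  fin_cases i <;> fin_cases j <;>
    simp [betaMat, J2, Matrix.mul_apply, Fin.sum_univ_succ]

theorem vasMatrix_mem (p : Sphere R 3) :
    IsAlternating (vasMatrix p.1) ∧ pf4 (vasMatrix p.1) = 1 := by
  have hp : p.1 = Sum.elim ![p.1 (Sum.inl 0), p.1 (Sum.inl 1), p.1 (Sum.inl 2)]
      ![p.1 (Sum.inr 0), p.1 (Sum.inr 1), p.1 (Sum.inr 2)] := by
    ext i
    rcases i with i | i <;> fin_cases i <;> rfl
  have hq := p.2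
  rw [hypQ_apply] at hq
  simp only [dotProduct, Fin.sum_univ_three] at hq
  rw [hp, vasMatrix_eq]
  refine ⟨⟨?_, ?_⟩, ?_⟩
  · ext i j
    fin_cases i <;> fin_cases j <;> simp
  · intro i
    fin_cases i <;> simp
  · refine Eq.trans ?_ hq
    simp [pf4]

/-- The map `(v, w) ↦ V(v, w)` from the unit sphere `U_5(R)` to `A_4(R)`. -/
def vas (p : Sphere R 3) : A4 R := ⟨vasMatrix p.1, vasMatrix_mem p⟩

end Alternating

end SpinVas

namespace SpinVas

open Matrix

/-! ### Vaserstein matrices and the spin representation of the Clifford algebra of $H(R^3)$. -/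

section SpinRepresentation

/-! The map $V$ is a linear bijection from $H(R^3)$ to alternating matrices that turns $q$ into the
Pfaffian, so it identifies $U_5(R)$ with $A_4(R)$ and only the group actions have to be compared.

Write $\bar p$ for $p$ with $v$ and $w$ interchanged. Since $V(p)V(\bar p)=-q(p)$, the off-diagonal
block matrices with blocks $V(p)$ and $-V(\bar p)$ satisfy the Clifford relation, and they define
`spinRep` from the Clifford algebra to $M_8(R)$. This is an isomorphism over every $R$
(`spinRep_surjective`, `spinRep_injective`). Even elements become block diagonal, and the standard
involution becomes the transpose followed by an exchange of the blocks. Hence an element of the Spin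
group with upper block $A$ acts by $M\mapsto AMA^{\intercal}$ (`exists_vasMatrix_spinProj`), and
conversely $g\in SL_4(R)$ is realised by the element with blocks $g$ and $(g^{-1})^{\intercal}$
(`exists_spin_of_specialLinear`).

The generators of $EO_6(R)$ and of $E_4(R)$ correspond under $V$ (`vasMatrix_eoMat`). So their
orbits agree, and, because $SL_4(R)$ lifts to the Spin group, $EO_6(R)$ lies in the image of $\pi$
and has the same orbits as $\mathrm{Epin}_6(R)$.

For rows, a generator of $EO_6(R)$ changes $v$ by an elementary operation or by a Koszul vector of
$w$, and the latter is also elementary on the sphere (`rowEquiv_add_koszul`). Conversely $E_3(R)$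
lifts to $EO_6(R)$, and points with the same $v$ lie in one $EO_6(R)$-orbit
(`exists_mem_EO_of_inl_eq`). -/

theorem hyp_three_eq {R : Type*} (p : Fin 3 ⊕ Fin 3 → R) :
    p = Sum.elim ![p (Sum.inl 0), p (Sum.inl 1), p (Sum.inl 2)]
      ![p (Sum.inr 0), p (Sum.inr 1), p (Sum.inr 2)] := by
  ext i
  rcases i with i | i <;> fin_cases i <;> rfl

variable {R : Type*} [CommRing R]

theorem hypQ_three (p : Hyp R 3) :
    hypQ R 3 p = p (Sum.inl 0) * p (Sum.inr 0) + p (Sum.inl 1) * p (Sum.inr 1) +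
      p (Sum.inl 2) * p (Sum.inr 2) := by
  rw [hypQ_apply]
  simp only [dotProduct, Fin.sum_univ_three]

theorem vasMatrix_eq_coord (p : Hyp R 3) :
    vasMatrix p = !![0, -p (Sum.inl 0), -p (Sum.inl 1), -p (Sum.inl 2);
      p (Sum.inl 0), 0, -p (Sum.inr 2), p (Sum.inr 1);
      p (Sum.inl 1), p (Sum.inr 2), 0, -p (Sum.inr 0);
      p (Sum.inl 2), -p (Sum.inr 1), p (Sum.inr 0), 0] := by
  conv_lhs => rw [hyp_three_eq p]
  rw [vasMatrix_eq]

theorem vasMatrix_transpose (p : Hyp R 3) : (vasMatrix p)ᵀ = -vasMatrix p := by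
  rw [vasMatrix_eq_coord]
  ext i j
  fin_cases i <;> fin_cases j <;> simp

theorem pf4_vasMatrix (p : Hyp R 3) : pf4 (vasMatrix p) = hypQ R 3 p := by
  rw [vasMatrix_eq_coord, hypQ_three]
  simp [pf4]

/-- The vector whose Vaserstein matrix is a given alternating matrix. -/
def vasInv (M : Matrix (Fin 4) (Fin 4) R) : Hyp R 3 :=
  Sum.elim ![M 1 0, M 2 0, M 3 0] ![M 3 2, M 1 3, M 2 1]

theorem vasMatrix_vasInv {M : Matrix (Fin 4) (Fin 4) R} (h : IsAlternating M) :
    vasMatrix (vasInv M) = M := by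
  have hs : ∀ i j, M j i = -M i j := fun i j => congrFun (congrFun h.1 i) j
  have h0 := h.2
  rw [vasInv, vasMatrix_eq]
  ext i j
  fin_cases i <;> fin_cases j <;> simp [h0, ← hs]

theorem vasInv_vasMatrix (p : Hyp R 3) : vasInv (vasMatrix p) = p := by
  rw [vasMatrix_eq_coord]
  conv_rhs => rw [hyp_three_eq p]
  simp [vasInv]

theorem vasMatrix_injective : Function.Injective (vasMatrix (R := R)) :=
  Function.LeftInverse.injective vasInv_vasMatrix

theorem vasMatrix_add (p p' : Hyp R 3) : vasMatrix (p + p') = vasMatrix p + vasMatrix p' := by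
  simp only [vasMatrix_eq_coord]
  ext i j
  fin_cases i <;> fin_cases j <;> simp <;> ring

theorem vasMatrix_smul (c : R) (p : Hyp R 3) : vasMatrix (c • p) = c • vasMatrix p := by
  simp only [vasMatrix_eq_coord]
  ext i j
  fin_cases i <;> fin_cases j <;> simp

theorem isAlternating_conj (g : Matrix (Fin 4) (Fin 4) R) (p : Hyp R 3) :
    IsAlternating (g * vasMatrix p * gᵀ) := by
  constructor
  · simp [Matrix.transpose_mul, vasMatrix_transpose, mul_assoc]
  · intro i
    rw [vasMatrix_eq_coord]
    simp [Matrix.mul_apply, Fin.sum_univ_four]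
    ring

/-- Linear in $\det g$, unlike the determinant of the conjugate: this is what later gives $\det g=1$
and not merely $(\det g)^2=1$. -/
theorem pf4_conj (g : Matrix (Fin 4) (Fin 4) R) (p : Hyp R 3) :
    pf4 (g * vasMatrix p * gᵀ) = g.det * hypQ R 3 p := by
  rw [hypQ_three, vasMatrix_eq_coord]
  simp [pf4, Matrix.mul_apply, Matrix.det_succ_row_zero, Fin.sum_univ_succ,
    Fin.succAbove]
  ring

/-- The involution of `H(R^3)` which interchanges `v` and `w`. -/
def hypSwap {R : Type*} (p : Fin 3 ⊕ Fin 3 → R) : Fin 3 ⊕ Fin 3 → R := fun i => p i.swap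

theorem hypSwap_hypSwap {R : Type*} (p : Fin 3 ⊕ Fin 3 → R) : hypSwap (hypSwap p) = p := by
  ext i
  simp [hypSwap]

theorem hypQ_hypSwap (p : Hyp R 3) : hypQ R 3 (hypSwap p) = hypQ R 3 p := by
  simp only [hypQ_three, hypSwap, Sum.swap_inl, Sum.swap_inr]
  ring

theorem vasMatrix_mul_hypSwap (p : Hyp R 3) :
    vasMatrix p * vasMatrix (hypSwap p) = -(hypQ R 3 p • (1 : Matrix (Fin 4) (Fin 4) R)) := by
  simp only [vasMatrix_eq_coord, hypQ_three, hypSwap, Sum.swap_inl, Sum.swap_inr]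
  ext i j
  fin_cases i <;> fin_cases j <;> simp [Matrix.mul_apply, Fin.sum_univ_four] <;> ring

theorem vasInv_add (M N : Matrix (Fin 4) (Fin 4) R) : vasInv (M + N) = vasInv M + vasInv N := by
  ext i
  rcases i with i | i <;> fin_cases i <;> simp [vasInv]

theorem vasInv_smul (c : R) (M : Matrix (Fin 4) (Fin 4) R) : vasInv (c • M) = c • vasInv M := by
  ext i
  rcases i with i | i <;> fin_cases i <;> simp [vasInv]

/-- This reduces linear identities in $p$ to points with $q(p)=1$, where $V(p)$ is invertible. -/
theorem span_sphere : Submodule.span R {p : Hyp R 3 | hypQ R 3 p = 1} = ⊤ := by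
  rw [eq_top_iff]
  rintro p -
  have hs : ∀ a b : Fin 3 → R, a 0 * b 0 + a 1 * b 1 + a 2 * b 2 = 1 →
      Sum.elim a b ∈ Submodule.span R {p : Hyp R 3 | hypQ R 3 p = 1} := fun a b h =>
    Submodule.subset_span ((hypQ_three _).trans h)
  -- $e_1+f_1$ is itself on the sphere, and $e_1,e_2,e_3,f_2,f_3$ are differences of two points of
  -- the sphere.
  have hp : p = p (Sum.inr 0) • Sum.elim ![1, 0, 0] ![1, 0, 0] +
      (p (Sum.inl 0) - p (Sum.inr 0)) •
        (Sum.elim ![1, 1, 0] ![0, 1, 0] - Sum.elim ![0, 1, 0] ![0, 1, 0]) +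
      p (Sum.inl 1) • (Sum.elim ![1, 1, 0] ![1, 0, 0] - Sum.elim ![1, 0, 0] ![1, 0, 0]) +
      p (Sum.inl 2) • (Sum.elim ![1, 0, 1] ![1, 0, 0] - Sum.elim ![1, 0, 0] ![1, 0, 0]) +
      p (Sum.inr 1) • (Sum.elim ![1, 0, 0] ![1, 1, 0] - Sum.elim ![1, 0, 0] ![1, 0, 0]) +
      p (Sum.inr 2) • (Sum.elim ![1, 0, 0] ![1, 0, 1] - Sum.elim ![1, 0, 0] ![1, 0, 0]) := by
    ext i
    rcases i with i | i <;> fin_cases i <;> simp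
  rw [hp]
  refine add_mem (add_mem (add_mem (add_mem (add_mem ?_ ?_) ?_) ?_) ?_) ?_
  · exact Submodule.smul_mem _ _ (hs _ _ (by simp))
  all_goals exact Submodule.smul_mem _ _ (sub_mem (hs _ _ (by simp)) (hs _ _ (by simp)))

/-- On the sphere $-V(\bar p)$ is the inverse of $V(p)$, so it must transform by the inverse
transpose of $g$. Both sides are linear in $p$ and the sphere spans, so the identity extends to all
$p$. -/
theorem vasMatrix_hypSwap_conj {g h : Matrix (Fin 4) (Fin 4) R} (hgh : g * h = 1)
    (hdet : g.det = 1) (p : Hyp R 3) :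
    vasMatrix (hypSwap (vasInv (g * vasMatrix p * gᵀ))) = hᵀ * vasMatrix (hypSwap p) * h := by
  have hp : p ∈ Submodule.span R {p : Hyp R 3 | hypQ R 3 p = 1} := by
    rw [span_sphere]
    trivial
  induction hp using Submodule.span_induction with
  | mem p hp =>
    have hp : hypQ R 3 p = 1 := hp
    have h1 := vasMatrix_mul_hypSwap (vasInv (g * vasMatrix p * gᵀ))
    rw [← pf4_vasMatrix, vasMatrix_vasInv (isAlternating_conj g p), pf4_conj, hdet, hp] at h1
    have h2 : g * vasMatrix p * gᵀ * (hᵀ * vasMatrix (hypSwap p) * h) =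
        -((1 * 1 : R) • 1) := by
      calc _ = g * (vasMatrix p * (h * g)ᵀ * vasMatrix (hypSwap p)) * h := by
            rw [transpose_mul]
            simp only [mul_assoc]
        _ = _ := by
            rw [mul_eq_one_comm.1 hgh, transpose_one, mul_one, vasMatrix_mul_hypSwap, hp]
            simp [hgh]
    have h3 : -(vasMatrix (hypSwap p)) * vasMatrix p = 1 := by
      have := vasMatrix_mul_hypSwap (hypSwap p)
      rw [hypSwap_hypSwap, hypQ_hypSwap, hp] at this
      simp [this]
    have h4 : (hᵀ * -(vasMatrix (hypSwap p)) * h) * (g * vasMatrix p * gᵀ) = 1 := by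
      rw [mul_eq_one_comm, mul_neg, neg_mul, mul_neg, h2]
      simp
    -- Both candidates give $-1$ when multiplied by $gV(p)g^{\intercal}$, which has the left inverse
    -- found in `h4` and cancels.
    have h5 := congrArg (fun X => (hᵀ * -(vasMatrix (hypSwap p)) * h) * X) (h1.trans h2.symm)
    simp only [← mul_assoc] at h5 h4
    simpa only [h4, one_mul] using h5
  | zero =>
    have h0 : vasMatrix (0 : Hyp R 3) = 0 := by simpa using vasMatrix_smul (0 : R) 0
    have h1 : vasInv (0 : Matrix (Fin 4) (Fin 4) R) = 0 := by simpa using vasInv_smul (0 : R) 0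
    have h2 : hypSwap (0 : Hyp R 3) = 0 := rfl
    simp [h0, h1, h2]
  | add p p' _ _ ih ih' =>
    have h2 : ∀ p p' : Hyp R 3, hypSwap (p + p') = hypSwap p + hypSwap p' := fun _ _ => rfl
    simp only [vasMatrix_add, mul_add, add_mul, vasInv_add, h2, ih, ih']
  | smul c p _ ih =>
    have h2 : ∀ p : Hyp R 3, hypSwap (c • p) = c • hypSwap p := fun _ => rfl
    simp only [vasMatrix_smul, Matrix.mul_smul, Matrix.smul_mul, vasInv_smul, h2, ih]

/-- The linear map underlying the spin representation of the Clifford algebra of `H(R^3)`. -/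
def spinRepLin : Hyp R 3 →ₗ[R] Matrix (Fin 4 ⊕ Fin 4) (Fin 4 ⊕ Fin 4) R where
  toFun p := fromBlocks 0 (vasMatrix p) (-vasMatrix (hypSwap p)) 0
  map_add' p p' := by
    have : hypSwap (p + p') = hypSwap p + hypSwap p' := rfl
    rw [this, fromBlocks_add]
    simp only [vasMatrix_add, add_zero, neg_add]
  map_smul' c p := by
    have : hypSwap (c • p) = c • hypSwap p := rfl
    rw [this, RingHom.id_apply, fromBlocks_smul]
    simp only [vasMatrix_smul, smul_zero, smul_neg]

theorem spinRepLin_apply (p : Hyp R 3) :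
    spinRepLin p = fromBlocks 0 (vasMatrix p) (-vasMatrix (hypSwap p)) 0 := rfl

theorem spinRepLin_mul_self (p : Hyp R 3) :
    spinRepLin p * spinRepLin p = algebraMap R _ (hypQ R 3 p) := by
  have h := vasMatrix_mul_hypSwap (hypSwap p)
  rw [hypSwap_hypSwap, hypQ_hypSwap] at h
  rw [spinRepLin_apply, fromBlocks_multiply]
  simp only [mul_neg, neg_mul, h, vasMatrix_mul_hypSwap, neg_neg, mul_zero, zero_mul, add_zero,
    zero_add, Algebra.algebraMap_eq_smul_one]
  rw [← fromBlocks_one, fromBlocks_smul]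
  simp

/-- The spin representation of the Clifford algebra of `H(R^3)` by `8 × 8` matrices. -/
noncomputable def spinRep : Cl R 3 →ₐ[R] Matrix (Fin 4 ⊕ Fin 4) (Fin 4 ⊕ Fin 4) R :=
  CliffordAlgebra.lift (hypQ R 3) ⟨spinRepLin, spinRepLin_mul_self⟩

theorem spinRep_incl (p : Hyp R 3) :
    spinRep (incl R 3 p) = fromBlocks 0 (vasMatrix p) (-vasMatrix (hypSwap p)) 0 := by
  rw [spinRep, CliffordAlgebra.lift_ι_apply, spinRepLin_apply]

theorem spinRep_even {x : Cl R 3} (hx : x ∈ CliffordAlgebra.evenOdd (hypQ R 3) 0) :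
    ∃ A D, spinRep x = fromBlocks A 0 0 D := by
  induction x, hx using CliffordAlgebra.even_induction with
  | algebraMap r =>
    refine ⟨r • 1, r • 1, ?_⟩
    rw [AlgHom.commutes, Algebra.algebraMap_eq_smul_one, ← fromBlocks_one, fromBlocks_smul]
    simp
  | add x y _ _ h h' =>
    obtain ⟨A, D, h⟩ := h
    obtain ⟨A', D', h'⟩ := h'
    exact ⟨A + A', D + D', by rw [map_add, h, h', fromBlocks_add]; simp⟩
  | ι_mul_ι_mul m m' x _ h =>
    obtain ⟨A, D, h⟩ := h
    rw [map_mul, map_mul, spinRep_incl, spinRep_incl, h]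
    simp only [fromBlocks_multiply, mul_zero, zero_mul, add_zero, zero_add]
    exact ⟨_, _, rfl⟩

theorem spinRep_odd {x : Cl R 3} (hx : x ∈ CliffordAlgebra.evenOdd (hypQ R 3) 1) :
    ∃ B C, spinRep x = fromBlocks 0 B C 0 := by
  induction x, hx using CliffordAlgebra.odd_induction with
  | ι m => exact ⟨_, _, spinRep_incl m⟩
  | add x y _ _ h h' =>
    obtain ⟨A, D, h⟩ := h
    obtain ⟨A', D', h'⟩ := h'
    exact ⟨A + A', D + D', by rw [map_add, h, h', fromBlocks_add]; simp⟩
  | ι_mul_ι_mul m m' x _ h =>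
    obtain ⟨A, D, h⟩ := h
    rw [map_mul, map_mul, spinRep_incl, spinRep_incl, h]
    simp only [fromBlocks_multiply, mul_zero, zero_mul, add_zero, zero_add]
    exact ⟨_, _, rfl⟩

/-- Both sides reverse products, so vectors suffice; there the sign $-1$ comes from $V$ being
skew-symmetric. -/
theorem spinRep_star (x : Cl R 3) :
    spinRep (star x) = fromBlocks 0 1 1 0 * (spinRep x)ᵀ * fromBlocks 0 1 1 0 := by
  have hK : (fromBlocks 0 1 1 0 * fromBlocks 0 1 1 0 :
      Matrix (Fin 4 ⊕ Fin 4) (Fin 4 ⊕ Fin 4) R) = 1 := by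
    simp [fromBlocks_multiply]
  induction x using CliffordAlgebra.induction with
  | algebraMap r =>
    rw [CliffordAlgebra.star_algebraMap, AlgHom.commutes, Algebra.algebraMap_eq_smul_one]
    simp [hK]
  | ι p =>
    rw [CliffordAlgebra.star_ι, map_neg, spinRep_incl]
    simp [fromBlocks_transpose, fromBlocks_multiply, vasMatrix_transpose, fromBlocks_neg]
  | mul a b ha hb =>
    rw [star_mul, map_mul, map_mul, ha, hb, transpose_mul]
    simp only [mul_assoc]
    rw [← mul_assoc (fromBlocks 0 1 1 0) (fromBlocks 0 1 1 0), hK, one_mul]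
  | add a b ha hb =>
    rw [star_add, map_add, map_add, ha, hb, transpose_add, mul_add, add_mul]

/-- A Spin group element acts on Vaserstein matrices as `M ↦ g M gᵀ` for some matrix `g`. -/
theorem exists_vasMatrix_spinProj (x : Spin R 3) :
    ∃ g : Matrix (Fin 4) (Fin 4) R, ∀ p : Hyp R 3,
      vasMatrix ((spinProj R 3 x : Matrix (Fin 3 ⊕ Fin 3) (Fin 3 ⊕ Fin 3) R) *ᵥ p) =
        g * vasMatrix p * gᵀ := by
  obtain ⟨A, D, h⟩ := spinRep_even x.2.1
  have hs : (((x : (Cl R 3)ˣ)⁻¹ : (Cl R 3)ˣ) : Cl R 3) = star ((x : (Cl R 3)ˣ) : Cl R 3) :=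
    Units.inv_eq_of_mul_eq_one_right x.2.2.1
  refine ⟨A, fun p => ?_⟩
  have h1 := congrArg spinRep (incl_spinProj R 3 x p)
  rw [map_mul, map_mul, hs, spinRep_star, h, spinRep_incl, spinRep_incl, fromBlocks_transpose,
    fromBlocks_multiply, fromBlocks_multiply, fromBlocks_multiply, fromBlocks_multiply] at h1
  -- If $x$ has diagonal blocks $A,D$, then $x^*$ has $D^{\intercal},A^{\intercal}$, so the upper
  -- right block of $xpx^*$ is $AV(p)A^{\intercal}$.
  have h2 := (fromBlocks_inj.1 h1).2.1
  simpa using h2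

end SpinRepresentation

/-! ### The isomorphism of the Clifford algebra with $M_8(R)$, and the lift of $SL_4(R)$ to the Spin
group. -/

section CliffordIso

variable {R : Type*} [CommRing R]

theorem exists_vasMatrix_apply_eq_one {i j : Fin 4} (h : i ≠ j) :
    ∃ p : Hyp R 3, vasMatrix p i j = 1 := by
  refine ⟨vasInv (single i j 1 - single j i 1), ?_⟩
  rw [vasMatrix_vasInv]
  · simp [h.symm]
  · constructor
    · simp [transpose_single]
    · intro k
      have h1 : ¬(i = k ∧ j = k) := fun hk => h (hk.1.trans hk.2.symm)
      have h2 : ¬(j = k ∧ i = k) := fun hk => h (hk.2.trans hk.1.symm)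
      simp [h1, h2]

theorem single_mul_mem_range {m l : Fin 4 ⊕ Fin 4}
    (hm : single m m 1 ∈ (spinRep (R := R)).range) (hl : single l l 1 ∈ (spinRep (R := R)).range)
    {x : Cl R 3} (hx : spinRep x m l = 1) : single m l 1 ∈ (spinRep (R := R)).range := by
  have := mul_mem (mul_mem hm ⟨x, rfl⟩) hl
  rw [single_mul_mul_single] at this
  simpa [hx] using this

variable (R) in
/-- The diagonal of the upper left block of the image of `e_i f_i` in the spin representation. -/
def planeDiag : Fin 3 → Fin 4 → R := ![![1, 1, 0, 0], ![1, 0, 1, 0], ![1, 0, 0, 1]]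

variable (R) in
/-- The diagonal of the lower right block of the image of `e_i f_i` in the spin representation. -/
def planeCoDiag : Fin 3 → Fin 4 → R := ![![0, 0, 1, 1], ![0, 1, 0, 1], ![0, 1, 1, 0]]

theorem one_sub_planeDiag (i : Fin 3) (k : Fin 4) : 1 - planeDiag R i k = planeCoDiag R i k := by
  fin_cases i <;> fin_cases k <;> simp [planeDiag, planeCoDiag]

theorem one_sub_planeCoDiag (i : Fin 3) (k : Fin 4) :
    1 - planeCoDiag R i k = planeDiag R i k := by
  rw [← one_sub_planeDiag, sub_sub_cancel]

theorem spinRep_incl_mul_inl_inr (i : Fin 3) :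
    spinRep (incl R 3 (Pi.single (Sum.inl i) 1) * incl R 3 (Pi.single (Sum.inr i) 1)) =
      diagonal (Sum.elim (planeDiag R i) (planeCoDiag R i)) := by
  rw [map_mul, spinRep_incl, spinRep_incl, fromBlocks_multiply, ← fromBlocks_diagonal]
  simp only [vasMatrix_eq_coord, hypSwap, mul_zero, zero_add, add_zero]
  fin_cases i <;>
  · congr 1
    all_goals
      refine Matrix.ext fun k l => ?_
      rw [Matrix.mul_apply, Fin.sum_univ_four]
      fin_cases k <;> fin_cases l <;> simp [planeDiag, planeCoDiag]

/-- The commuting idempotents $e_if_i$ act by $0/1$ diagonals, and each of the eight patterns in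
$\{0,1\}^3$ occurs at exactly one coordinate. Choosing $e_if_i$ or $1-e_if_i$ for each $i$ and
multiplying isolates that coordinate. -/
theorem single_self_mem_range (m : Fin 4 ⊕ Fin 4) :
    single m m 1 ∈ (spinRep (R := R)).range := by
  have hd : ∀ i : Fin 3, (diagonal (Sum.elim (planeDiag R i) (planeCoDiag R i)) :
        Matrix (Fin 4 ⊕ Fin 4) (Fin 4 ⊕ Fin 4) R) ∈ (spinRep (R := R)).range := fun i =>
    ⟨_, spinRep_incl_mul_inl_inr i⟩
  have hd' : ∀ i : Fin 3, (diagonal (Sum.elim (planeCoDiag R i) (planeDiag R i)) :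
        Matrix (Fin 4 ⊕ Fin 4) (Fin 4 ⊕ Fin 4) R) ∈ (spinRep (R := R)).range := by
    intro i
    have := sub_mem (one_mem _) (hd i)
    rw [← diagonal_one, diagonal_sub] at this
    have h : (fun k : Fin 4 ⊕ Fin 4 => 1 - Sum.elim (planeDiag R i) (planeCoDiag R i) k) =
        Sum.elim (planeCoDiag R i) (planeDiag R i) := by
      funext k
      rcases k with k | k <;> simp [one_sub_planeDiag, one_sub_planeCoDiag]
    rwa [h] at this
  have key : ∀ d₀ d₁ d₂ : Fin 4 ⊕ Fin 4 → R, diagonal d₀ ∈ (spinRep (R := R)).range →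
      diagonal d₁ ∈ (spinRep (R := R)).range → diagonal d₂ ∈ (spinRep (R := R)).range →
      (∀ k, d₀ k * d₁ k * d₂ k = Pi.single (M := fun _ => R) m 1 k) →
      single m m 1 ∈ (spinRep (R := R)).range := by
    intro d₀ d₁ d₂ h₀ h₁ h₂ h
    have := mul_mem (mul_mem h₀ h₁) h₂
    rw [diagonal_mul_diagonal, diagonal_mul_diagonal, funext h, diagonal_single] at this
    exact this
  rcases m with m | m <;> fin_cases m
  · refine key _ _ _ (hd 0) (hd 1) (hd 2) ?_
    rintro (k | k) <;> fin_cases k <;> simp [planeDiag, planeCoDiag]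
  · refine key _ _ _ (hd 0) (hd' 1) (hd' 2) ?_
    rintro (k | k) <;> fin_cases k <;> simp [planeDiag, planeCoDiag]
  · refine key _ _ _ (hd' 0) (hd 1) (hd' 2) ?_
    rintro (k | k) <;> fin_cases k <;> simp [planeDiag, planeCoDiag]
  · refine key _ _ _ (hd' 0) (hd' 1) (hd 2) ?_
    rintro (k | k) <;> fin_cases k <;> simp [planeDiag, planeCoDiag]
  · refine key _ _ _ (hd' 0) (hd' 1) (hd' 2) ?_
    rintro (k | k) <;> fin_cases k <;> simp [planeDiag, planeCoDiag]
  · refine key _ _ _ (hd' 0) (hd 1) (hd 2) ?_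
    rintro (k | k) <;> fin_cases k <;> simp [planeDiag, planeCoDiag]
  · refine key _ _ _ (hd 0) (hd' 1) (hd 2) ?_
    rintro (k | k) <;> fin_cases k <;> simp [planeDiag, planeCoDiag]
  · refine key _ _ _ (hd 0) (hd 1) (hd' 2) ?_
    rintro (k | k) <;> fin_cases k <;> simp [planeDiag, planeCoDiag]

/-- Cutting the image of a vector down by diagonal matrix units gives the units in the off-diagonal
blocks, except on their diagonals, where alternating matrices vanish. The other units are products
passing through an auxiliary index. -/
theorem single_mem_range (m l : Fin 4 ⊕ Fin 4) : single m l 1 ∈ (spinRep (R := R)).range := by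
  have htrans : ∀ {m l k : Fin 4 ⊕ Fin 4}, single m l 1 ∈ (spinRep (R := R)).range →
      single l k 1 ∈ (spinRep (R := R)).range → single m k 1 ∈ (spinRep (R := R)).range := by
    intro m l k h h'
    simpa using mul_mem h h'
  have h1 : ∀ {i j : Fin 4}, i ≠ j →
      single (Sum.inl i) (Sum.inr j) 1 ∈ (spinRep (R := R)).range := by
    intro i j h
    obtain ⟨p, hp⟩ := exists_vasMatrix_apply_eq_one (R := R) h
    refine single_mul_mem_range (single_self_mem_range _) (single_self_mem_range _)
      (x := incl R 3 p) ?_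
    rw [spinRep_incl, fromBlocks_apply₁₂, hp]
  have h2 : ∀ {i j : Fin 4}, i ≠ j →
      single (Sum.inr i) (Sum.inl j) 1 ∈ (spinRep (R := R)).range := by
    intro i j h
    obtain ⟨p, hp⟩ := exists_vasMatrix_apply_eq_one (R := R) h.symm
    refine single_mul_mem_range (single_self_mem_range _) (single_self_mem_range _)
      (x := incl R 3 (hypSwap p)) ?_
    have := congrFun (congrFun (vasMatrix_transpose p) i) j
    rw [transpose_apply, hp] at this
    rw [spinRep_incl, fromBlocks_apply₂₁, hypSwap_hypSwap, ← this]
  have hk : ∀ i j : Fin 4, ∃ k, k ≠ i ∧ k ≠ j := by decide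
  have h3 : ∀ i j : Fin 4, single (Sum.inl i) (Sum.inl j) 1 ∈ (spinRep (R := R)).range := by
    intro i j
    obtain ⟨k, hi, hj⟩ := hk i j
    exact htrans (h1 hi.symm) (h2 hj)
  have h4 : ∀ i j : Fin 4, single (Sum.inr i) (Sum.inr j) 1 ∈ (spinRep (R := R)).range := by
    intro i j
    obtain ⟨k, hi, hj⟩ := hk i j
    exact htrans (h2 hi.symm) (h1 hj)
  rcases m with m | m <;> rcases l with l | l
  · exact h3 m l
  · obtain ⟨k, hk, -⟩ := hk l l
    exact htrans (h3 m k) (h1 hk)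
  · obtain ⟨k, hk, -⟩ := hk l l
    exact htrans (h4 m k) (h2 hk)
  · exact h4 m l

theorem spinRep_surjective : Function.Surjective (spinRep (R := R)) := by
  intro X
  have : X ∈ (spinRep (R := R)).range := by
    rw [matrix_eq_sum_single X]
    refine sum_mem fun i _ => sum_mem fun j _ => ?_
    have := Subalgebra.smul_mem _ (single_mem_range (R := R) i j) (X i j)
    rwa [smul_single, smul_eq_mul, mul_one] at this
  exact this

/-- The generators `e_i`, `f_i` of the `i`-th hyperbolic plane in the Clifford algebra. -/
def planeGen (i : Fin 3) : Set (Cl R 3) :=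
  {incl R 3 (Pi.single (Sum.inl i) 1), incl R 3 (Pi.single (Sum.inr i) 1)}

variable (R) in
/-- The elements `1, e_i, f_i, e_i f_i` of the Clifford algebra. -/
noncomputable def planeBasis (i : Fin 3) : Fin 4 → Cl R 3 :=
  ![1, incl R 3 (Pi.single (Sum.inl i) 1), incl R 3 (Pi.single (Sum.inr i) 1),
    incl R 3 (Pi.single (Sum.inl i) 1) * incl R 3 (Pi.single (Sum.inr i) 1)]

variable (R) in
/-- The span of `1, e_i, f_i, e_i f_i` in the Clifford algebra. -/
noncomputable def planeSpan (i : Fin 3) : Submodule R (Cl R 3) :=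
  Submodule.span R (Set.range (planeBasis R i))

theorem polar_hypQ (p p' : Hyp R 3) : QuadraticMap.polar (hypQ R 3) p p' =
    ∑ i, (p (Sum.inl i) * p' (Sum.inr i) + p' (Sum.inl i) * p (Sum.inr i)) := by
  simp only [QuadraticMap.polar, hypQ_three, Fin.sum_univ_three, Pi.add_apply]
  ring

theorem incl_single_sq (s : Fin 3 ⊕ Fin 3) :
    incl R 3 (Pi.single s 1) * incl R 3 (Pi.single s 1) = 0 := by
  rw [CliffordAlgebra.ι_sq_scalar, hypQ_apply, dotProduct]
  rcases s with s | s <;> simp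

theorem incl_inr_mul_inl (i : Fin 3) :
    incl R 3 (Pi.single (Sum.inr i) 1) * incl R 3 (Pi.single (Sum.inl i) 1) =
      1 - incl R 3 (Pi.single (Sum.inl i) 1) * incl R 3 (Pi.single (Sum.inr i) 1) := by
  rw [CliffordAlgebra.ι_mul_ι_comm, polar_hypQ]
  simp [Pi.single_apply]

theorem planeGen_anticomm {i j : Fin 3} (h : i ≠ j) {u x : Cl R 3} (hu : u ∈ planeGen j)
    (hx : x ∈ planeGen i) : u * x = -(x * u) := by
  rcases hu with rfl | rfl <;> rcases hx with rfl | rfl <;>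
  · rw [CliffordAlgebra.ι_mul_ι_comm, polar_hypQ]
    simp [Pi.single_apply, h, h.symm]

theorem planeBasis_mem (i : Fin 3) (k : Fin 4) : planeBasis R i k ∈ planeSpan R i :=
  Submodule.subset_span (Set.mem_range_self k)

theorem span_planeGen_mul_planeSpan_le (i : Fin 3) :
    Submodule.span R (planeGen i) * planeSpan R i ≤ planeSpan R i := by
  rw [planeSpan, Submodule.span_mul_span, Submodule.span_le]
  rintro _ ⟨u, hu, _, ⟨k, rfl⟩, rfl⟩
  change _ ∈ planeSpan R i
  have h0 : (1 : Cl R 3) ∈ planeSpan R i := planeBasis_mem i 0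
  have h1 : incl R 3 (Pi.single (Sum.inl i) 1) ∈ planeSpan R i := planeBasis_mem i 1
  have h2 : incl R 3 (Pi.single (Sum.inr i) 1) ∈ planeSpan R i := planeBasis_mem i 2
  have h3 : incl R 3 (Pi.single (Sum.inl i) 1) * incl R 3 (Pi.single (Sum.inr i) 1) ∈
    planeSpan R i := planeBasis_mem i 3
  change u * planeBasis R i k ∈ planeSpan R i
  have hb0 : planeBasis R i 0 = 1 := rfl
  have hb1 : planeBasis R i 1 = incl R 3 (Pi.single (Sum.inl i) 1) := rfl
  have hb2 : planeBasis R i 2 = incl R 3 (Pi.single (Sum.inr i) 1) := rfl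
  have hb3 : planeBasis R i 3 =
    incl R 3 (Pi.single (Sum.inl i) 1) * incl R 3 (Pi.single (Sum.inr i) 1) := rfl
  rcases hu with rfl | rfl <;> fin_cases k <;> dsimp only [Fin.zero_eta, Fin.mk_one,
    Fin.reduceFinMk]
  · rwa [hb0, mul_one]
  · rw [hb1, incl_single_sq]
    exact zero_mem _
  · rwa [hb2]
  · rw [hb3, ← mul_assoc, incl_single_sq, zero_mul]
    exact zero_mem _
  · rwa [hb0, mul_one]
  · rw [hb1, incl_inr_mul_inl]
    exact sub_mem h0 h3
  · rw [hb2, incl_single_sq]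
    exact zero_mem _
  · rw [hb3, ← mul_assoc, incl_inr_mul_inl, sub_mul, mul_assoc, incl_single_sq, mul_zero, sub_zero,
      one_mul]
    exact h2

theorem span_planeGen_mul_planeSpan_le_of_ne {i j : Fin 3} (h : i ≠ j) :
    Submodule.span R (planeGen j) * planeSpan R i ≤
      planeSpan R i * Submodule.span R (planeGen j) := by
  rw [planeSpan, Submodule.span_mul_span, Submodule.span_le]
  rintro _ ⟨u, hu, _, ⟨k, rfl⟩, rfl⟩
  have hU : u ∈ Submodule.span R (planeGen j) := Submodule.subset_span hu
  have hm : planeBasis R i k * u ∈ planeSpan R i * Submodule.span R (planeGen j) :=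
    Submodule.mul_mem_mul (planeBasis_mem i k) hU
  have e1 := planeGen_anticomm h hu (x := incl R 3 (Pi.single (Sum.inl i) 1)) (Or.inl rfl)
  have e2 := planeGen_anticomm h hu (x := incl R 3 (Pi.single (Sum.inr i) 1)) (Or.inr rfl)
  have : u * planeBasis R i k = planeBasis R i k * u ∨
      u * planeBasis R i k = -(planeBasis R i k * u) := by
    fin_cases k
    · exact Or.inl (by simp [planeBasis])
    · exact Or.inr e1
    · exact Or.inr e2
    · refine Or.inl ?_
      change u * (_ * _) = (_ * _) * u
      rw [← mul_assoc, e1, neg_mul, mul_assoc, e2, mul_neg, neg_neg, mul_assoc]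
  rcases this with h' | h'
  · exact (congrArg (· ∈ planeSpan R i * Submodule.span R (planeGen j)) h').mpr hm
  · exact (congrArg (· ∈ planeSpan R i * Submodule.span R (planeGen j)) h').mpr (neg_mem hm)

theorem incl_mem_sup (p : Hyp R 3) : incl R 3 p ∈ Submodule.span R (planeGen 0) ⊔
    Submodule.span R (planeGen 1) ⊔ Submodule.span R (planeGen 2) := by
  rw [← Submodule.span_union, ← Submodule.span_union, ← Finset.univ_sum_single p, map_sum]
  refine sum_mem fun s _ => ?_
  have : (Pi.single s (p s) : Hyp R 3) = p s • Pi.single s 1 := by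
    rw [← Pi.single_smul, smul_eq_mul, mul_one]
  rw [this, map_smul]
  refine Submodule.smul_mem _ _ (Submodule.subset_span ?_)
  rcases s with s | s <;> fin_cases s <;> simp [planeGen]

/-- The product contains $1$ and is stable under left multiplication by vectors: each vector splits
along the three hyperbolic planes, and each component moves past the preceding planes up to sign
until it is absorbed by its own. So 64 products span the Clifford algebra. -/
theorem planeSpan_mul_eq_top : planeSpan R 0 * planeSpan R 1 * planeSpan R 2 = ⊤ := by
  have hU0 : Submodule.span R (planeGen 0) * (planeSpan R 0 * planeSpan R 1 * planeSpan R 2) ≤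
      planeSpan R 0 * planeSpan R 1 * planeSpan R 2 := by
    rw [← mul_assoc, ← mul_assoc]
    gcongr ?_ * planeSpan R 1 * planeSpan R 2
    exact span_planeGen_mul_planeSpan_le 0
  have hU1 : Submodule.span R (planeGen 1) * (planeSpan R 0 * planeSpan R 1 * planeSpan R 2) ≤
      planeSpan R 0 * planeSpan R 1 * planeSpan R 2 := by
    calc _ = (Submodule.span R (planeGen 1) * planeSpan R 0) * planeSpan R 1 * planeSpan R 2 := by
          simp only [mul_assoc]
      _ ≤ (planeSpan R 0 * Submodule.span R (planeGen 1)) * planeSpan R 1 * planeSpan R 2 := by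
          gcongr ?_ * planeSpan R 1 * planeSpan R 2
          exact span_planeGen_mul_planeSpan_le_of_ne (i := 0) (j := 1) (by decide)
      _ = planeSpan R 0 * (Submodule.span R (planeGen 1) * planeSpan R 1) * planeSpan R 2 := by
          simp only [mul_assoc]
      _ ≤ _ := by
          gcongr planeSpan R 0 * ?_ * planeSpan R 2
          exact span_planeGen_mul_planeSpan_le 1
  have hU2 : Submodule.span R (planeGen 2) * (planeSpan R 0 * planeSpan R 1 * planeSpan R 2) ≤
      planeSpan R 0 * planeSpan R 1 * planeSpan R 2 := by
    calc _ = (Submodule.span R (planeGen 2) * planeSpan R 0) * (planeSpan R 1 * planeSpan R 2) := by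
          simp only [mul_assoc]
      _ ≤ (planeSpan R 0 * Submodule.span R (planeGen 2)) * (planeSpan R 1 * planeSpan R 2) := by
          gcongr ?_ * (planeSpan R 1 * planeSpan R 2)
          exact span_planeGen_mul_planeSpan_le_of_ne (i := 0) (j := 2) (by decide)
      _ = planeSpan R 0 * (Submodule.span R (planeGen 2) * planeSpan R 1) * planeSpan R 2 := by
          simp only [mul_assoc]
      _ ≤ planeSpan R 0 * (planeSpan R 1 * Submodule.span R (planeGen 2)) * planeSpan R 2 := by
          gcongr planeSpan R 0 * ?_ * planeSpan R 2
          exact span_planeGen_mul_planeSpan_le_of_ne (i := 1) (j := 2) (by decide)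
      _ = planeSpan R 0 * planeSpan R 1 * (Submodule.span R (planeGen 2) * planeSpan R 2) := by
          simp only [mul_assoc]
      _ ≤ _ := by
          gcongr planeSpan R 0 * planeSpan R 1 * ?_
          exact span_planeGen_mul_planeSpan_le 2
  have hU := sup_le (sup_le hU0 hU1) hU2
  rw [← Submodule.sup_mul, ← Submodule.sup_mul] at hU
  rw [eq_top_iff]
  rintro x -
  induction x using CliffordAlgebra.left_induction with
  | algebraMap r =>
    have h1 : (1 : Cl R 3) ∈ planeSpan R 0 * planeSpan R 1 * planeSpan R 2 := by
      simpa [planeBasis] using Submodule.mul_mem_mul (Submodule.mul_mem_mul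
        (planeBasis_mem (R := R) 0 0) (planeBasis_mem (R := R) 1 0)) (planeBasis_mem (R := R) 2 0)
    rw [Algebra.algebraMap_eq_smul_one]
    exact Submodule.smul_mem _ _ h1
  | add x y hx hy => exact add_mem hx hy
  | ι_mul x p hx => exact hU (Submodule.mul_mem_mul (incl_mem_sup p) hx)

/-- Composing the map $R^{64}\to Cl$ given by the 64 spanning products with the surjection onto
$M_8(R)\cong R^{64}$ gives a surjective endomorphism of a finitely generated module over a
commutative ring, which is injective. No independence of the products has to be known beforehand. -/
theorem spinRep_injective : Function.Injective (spinRep (R := R)) := by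
  let b : Fin 4 × Fin 4 × Fin 4 → Cl R 3 := fun t =>
    planeBasis R 0 t.1 * planeBasis R 1 t.2.1 * planeBasis R 2 t.2.2
  have hb : Function.Surjective (Fintype.linearCombination R b) := by
    rw [← LinearMap.range_eq_top, Fintype.range_linearCombination, eq_top_iff,
      ← planeSpan_mul_eq_top, planeSpan, planeSpan, planeSpan, Submodule.span_mul_span,
      Submodule.span_mul_span]
    refine Submodule.span_mono ?_
    rintro _ ⟨_, ⟨_, ⟨i, rfl⟩, _, ⟨j, rfl⟩, rfl⟩, _, ⟨k, rfl⟩, rfl⟩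
    exact ⟨(i, j, k), rfl⟩
  have hcard : Fintype.card ((Fin 4 ⊕ Fin 4) × (Fin 4 ⊕ Fin 4)) =
      Fintype.card (Fin 4 × Fin 4 × Fin 4) := by
    simp only [Fintype.card_prod, Fintype.card_sum, Fintype.card_fin]
  obtain ⟨e⟩ : Nonempty
      (Matrix (Fin 4 ⊕ Fin 4) (Fin 4 ⊕ Fin 4) R ≃ₗ[R] (Fin 4 × Fin 4 × Fin 4 → R)) :=
    ⟨(LinearEquiv.curry R R (Fin 4 ⊕ Fin 4) (Fin 4 ⊕ Fin 4)).symm.trans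
      (LinearEquiv.funCongrLeft R R (Fintype.equivOfCardEq hcard).symm)⟩
  generalize Fintype.linearCombination R b = T at hb
  obtain ⟨φ, hφ⟩ : ∃ φ : Cl R 3 →ₗ[R] Matrix (Fin 4 ⊕ Fin 4) (Fin 4 ⊕ Fin 4) R,
      ∀ x, φ x = spinRep x := ⟨spinRep.toLinearMap, fun _ => rfl⟩
  have hφs : Function.Surjective φ := fun X =>
    (spinRep_surjective X).imp fun x hx => (hφ x).trans hx
  have hinj := OrzechProperty.injective_of_surjective_endomorphism (e.toLinearMap ∘ₗ φ ∘ₗ T)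
    (e.surjective.comp (hφs.comp hb))
  intro x y hxy
  rw [← hφ, ← hφ] at hxy
  obtain ⟨x, rfl⟩ := hb x
  obtain ⟨y, rfl⟩ := hb y
  exact congrArg T (hinj (congrArg e hxy))

/-- Every `g` in `SL_4(R)` comes from an element of the Spin group. -/
theorem exists_spin_of_specialLinear (g : SpecialLinearGroup (Fin 4) R) :
    ∃ x : Spin R 3, ∀ p : Hyp R 3,
      vasMatrix ((spinProj R 3 x : Matrix (Fin 3 ⊕ Fin 3) (Fin 3 ⊕ Fin 3) R) *ᵥ p) =
        (g : Matrix (Fin 4) (Fin 4) R) * vasMatrix p * (g : Matrix (Fin 4) (Fin 4) R)ᵀ := by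
  -- Any preimage may be replaced by its even part, since the odd part contributes only off-diagonal
  -- blocks.
  have hlift : ∀ g h : Matrix (Fin 4) (Fin 4) R,
      ∃ x ∈ CliffordAlgebra.evenOdd (hypQ R 3) 0, spinRep x = fromBlocks g 0 0 h := by
    intro g h
    obtain ⟨x, hx⟩ := spinRep_surjective (fromBlocks g 0 0 h)
    have htop : x ∈ CliffordAlgebra.evenOdd (hypQ R 3) 0 ⊔ CliffordAlgebra.evenOdd (hypQ R 3) 1 :=
      (CliffordAlgebra.evenOdd_isCompl (hypQ R 3)).sup_eq_top ▸ Submodule.mem_top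
    obtain ⟨y, hy, z, hz, rfl⟩ := Submodule.mem_sup.1 htop
    refine ⟨y, hy, ?_⟩
    obtain ⟨A, D, h1⟩ := spinRep_even hy
    obtain ⟨B, C, h2⟩ := spinRep_odd hz
    rw [map_add, h1, h2, fromBlocks_add] at hx
    obtain ⟨ha, -, -, hd⟩ := fromBlocks_inj.1 hx
    rw [h1, ← ha, ← hd]
    simp
  have hconj : ∀ {g h : Matrix (Fin 4) (Fin 4) R}, g.det = 1 → g * h = 1 → ∀ p : Hyp R 3,
      (fromBlocks g 0 0 hᵀ * spinRep (incl R 3 p) * fromBlocks h 0 0 gᵀ :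
        Matrix (Fin 4 ⊕ Fin 4) (Fin 4 ⊕ Fin 4) R) =
      spinRep (incl R 3 (vasInv (g * vasMatrix p * gᵀ))) := by
    intro g h hg hgh p
    rw [spinRep_incl, spinRep_incl, vasMatrix_vasInv (isAlternating_conj g p),
      vasMatrix_hypSwap_conj hgh hg, fromBlocks_multiply, fromBlocks_multiply]
    simp
  set G : Matrix (Fin 4) (Fin 4) R := (g : Matrix (Fin 4) (Fin 4) R) with hG
  set H : Matrix (Fin 4) (Fin 4) R :=
    ((g⁻¹ : SpecialLinearGroup (Fin 4) R) : Matrix (Fin 4) (Fin 4) R) with hH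
  have hGH : G * H = 1 := congrArg Subtype.val (mul_inv_cancel g)
  have hHG : H * G = 1 := congrArg Subtype.val (inv_mul_cancel g)
  -- The lower block $(g^{-1})^{\intercal}$ is forced by $xx^*=1$, because $x^*$ then has blocks
  -- $g^{-1}$ and $g^{\intercal}$.
  obtain ⟨x, hx, hxr⟩ := hlift G Hᵀ
  have hst : spinRep (star x) = fromBlocks H 0 0 Gᵀ := by
    rw [spinRep_star, hxr]
    simp [fromBlocks_transpose, fromBlocks_multiply]
  have hxs : x * star x = 1 := by
    apply spinRep_injective
    rw [map_mul, hxr, hst, fromBlocks_multiply, map_one]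
    simp [hGH, ← transpose_mul]
  have hsx : star x * x = 1 := by
    apply spinRep_injective
    rw [map_mul, hxr, hst, fromBlocks_multiply, map_one]
    simp [hHG, ← transpose_mul]
  have hconj1 : ∀ p, x * incl R 3 p * star x = incl R 3 (vasInv (G * vasMatrix p * Gᵀ)) := by
    intro p
    apply spinRep_injective
    rw [map_mul, map_mul, hxr, hst, hconj g.2 hGH]
  have hconj2 : ∀ p, star x * incl R 3 p * x = incl R 3 (vasInv (H * vasMatrix p * Hᵀ)) := by
    intro p
    apply spinRep_injective
    rw [map_mul, map_mul, hxr, hst, hconj (g⁻¹).2 hHG]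
  refine ⟨⟨⟨x, star x, hxs, hsx⟩, hx, hxs, ?_⟩, fun p => ?_⟩
  · apply Set.Subset.antisymm
    · rintro _ ⟨_, ⟨p, rfl⟩, rfl⟩
      exact ⟨_, (hconj1 p).symm⟩
    · rintro _ ⟨p, rfl⟩
      refine ⟨_, ⟨_, (hconj2 p).symm⟩, ?_⟩
      change x * (star x * incl R 3 p * x) * star x = _
      rw [← mul_assoc, ← mul_assoc, hxs, one_mul, mul_assoc, hxs, mul_one]
  · rw [← vasMatrix_vasInv (isAlternating_conj G p)]
    congr 1
    apply incl_injective R 3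
    rw [incl_spinProj, ← hconj1]
    rfl

end CliffordIso

/-! ### Generators of the elementary orthogonal group. -/

section ElementaryOrthogonal

variable {R : Type*} [CommRing R] {n : ℕ}

/-- The matrix `1 + c (e_{ij} - e_{∂(j)∂(i)})`. -/
def eoMat (i j : Fin n ⊕ Fin n) (c : R) : Matrix (Fin n ⊕ Fin n) (Fin n ⊕ Fin n) R :=
  1 + c • (Matrix.single i j 1 - Matrix.single j.swap i.swap 1)

theorem eoMat_mulVec (i j : Fin n ⊕ Fin n) (c : R) (p : Hyp R n) :
    eoMat i j c *ᵥ p = p + c • (Pi.single i (p j) - Pi.single j.swap (p i.swap)) := by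
  rw [eoMat, add_mulVec, one_mulVec, smul_mulVec, sub_mulVec, single_mulVec_eq, single_mulVec_eq,
    ← Pi.single_smul, ← Pi.single_smul]
  simp

theorem eoMat_swap (i j : Fin n ⊕ Fin n) (c : R) : eoMat j.swap i.swap (-c) = eoMat i j c := by
  simp [eoMat, ← smul_neg]

theorem eoMat_of_eq_swap (i : Fin n ⊕ Fin n) (c : R) : eoMat i i.swap c = 1 := by
  simp [eoMat]

theorem eoMat_mul_neg {i j : Fin n ⊕ Fin n} (h : i ≠ j) (c : R) :
    eoMat i j c * eoMat i j (-c) = 1 := by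
  have h1 : i.swap ≠ j.swap := fun e => h (by simpa using congrArg Sum.swap e)
  have h2 : ∀ k : Fin n ⊕ Fin n, k ≠ k.swap := by rintro (k | k) <;> simp
  -- The generator is $1+cN$ with $N^2=0$, because $i\ne j$ and $\partial$ has no fixed point.
  have hN : (Matrix.single i j 1 - Matrix.single j.swap i.swap 1 :
      Matrix (Fin n ⊕ Fin n) (Fin n ⊕ Fin n) R) *
      (Matrix.single i j 1 - Matrix.single j.swap i.swap 1) = 0 := by
    simp [mul_sub, sub_mul, h.symm, h1, h2, (h2 _).symm]
  rw [eoMat, eoMat, add_mul, one_mul, mul_add, mul_one, Matrix.smul_mul, Matrix.mul_smul, hN]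
  simp

/-- The generators of the elementary orthogonal group, as invertible matrices. -/
def eoGen {i j : Fin n ⊕ Fin n} (h : i ≠ j) (c : R) : GL (Fin n ⊕ Fin n) R where
  val := eoMat i j c
  inv := eoMat i j (-c)
  val_inv := eoMat_mul_neg h c
  inv_val := by simpa using eoMat_mul_neg h (-c)

theorem eoGen_mem {i j : Fin n ⊕ Fin n} (h : i ≠ j) (c : R) : eoGen h c ∈ EO R n :=
  Subgroup.subset_closure ⟨i, j, h, c, rfl⟩

theorem coe_eoGen {i j : Fin n ⊕ Fin n} (h : i ≠ j) (c : R) :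
    (eoGen h c : Matrix (Fin n ⊕ Fin n) (Fin n ⊕ Fin n) R) = eoMat i j c := rfl

theorem hypQ_add_single (p : Hyp R n) (s : Fin n ⊕ Fin n) (x : R) :
    hypQ R n (p + Pi.single s x) = hypQ R n p + p s.swap * x := by
  simp only [hypQ_apply, dotProduct, Pi.add_apply]
  rcases s with s | s
  · simp [add_mul, Finset.sum_add_distrib, Pi.single_apply, mul_comm]
  · simp [mul_add, Finset.sum_add_distrib, Pi.single_apply]

theorem hypQ_eoMat_mulVec {i j : Fin n ⊕ Fin n} (h : i ≠ j) (c : R) (p : Hyp R n) :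
    hypQ R n (eoMat i j c *ᵥ p) = hypQ R n p := by
  have : eoMat i j c *ᵥ p = p + Pi.single i (c * p j) + Pi.single j.swap (-(c * p i.swap)) := by
    rw [eoMat_mulVec, smul_sub, ← Pi.single_smul, ← Pi.single_smul, Pi.single_neg, add_assoc,
      sub_eq_add_neg, smul_eq_mul, smul_eq_mul]
  rw [this, hypQ_add_single, hypQ_add_single, Sum.swap_swap, Pi.add_apply,
    Pi.single_eq_of_ne h.symm]
  ring

end ElementaryOrthogonal

/-! ### The correspondence of $EO_6(R)$ with $E_4(R)$, and of the Spin action with $SL_4(R)$. -/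

section VasersteinEquivariance

variable {R : Type*} [CommRing R]

/-- The indices `(i, j)` such that `1 + c (e_{ij} - e_{∂(j)∂(i)})` corresponds to the elementary
matrix `1 + c e_{kl}` under the Vaserstein map. -/
def eoIndex : Fin 4 → Fin 4 → (Fin 3 ⊕ Fin 3) × (Fin 3 ⊕ Fin 3) :=
  ![![(Sum.inl 0, Sum.inl 0), (Sum.inl 1, Sum.inr 2), (Sum.inl 2, Sum.inr 0),
      (Sum.inl 0, Sum.inr 1)],
    ![(Sum.inr 2, Sum.inl 1), (Sum.inl 0, Sum.inl 0), (Sum.inl 0, Sum.inl 1),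
      (Sum.inl 0, Sum.inl 2)],
    ![(Sum.inr 0, Sum.inl 2), (Sum.inl 1, Sum.inl 0), (Sum.inl 0, Sum.inl 0),
      (Sum.inl 1, Sum.inl 2)],
    ![(Sum.inr 1, Sum.inl 0), (Sum.inl 2, Sum.inl 0), (Sum.inl 2, Sum.inl 1),
      (Sum.inl 0, Sum.inl 0)]]

theorem eoIndex_ne : ∀ {k l : Fin 4}, k ≠ l → (eoIndex k l).1 ≠ (eoIndex k l).2 := by
  decide

/-- Of the 30 pairs $i\ne j$, the six with $j=\partial(i)$ give the identity matrix. The other 24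
fall into 12 classes under $(i,j)\sim(\partial(j),\partial(i))$, one for each elementary position in
$E_4$. -/
theorem exists_eoIndex_eq : ∀ i j : Fin 3 ⊕ Fin 3, i ≠ j → j = i.swap ∨
    ∃ k l, k ≠ l ∧ (eoIndex k l = (i, j) ∨ eoIndex k l = (j.swap, i.swap)) := by
  decide

theorem transvection_conj_apply (k l : Fin 4) (c : R) (M : Matrix (Fin 4) (Fin 4) R)
    (a b : Fin 4) : (transvection k l c * M * (transvection k l c)ᵀ) a b =
      M a b + (if a = k then c * M l b else 0) + (if b = k then c * M a l else 0) +
        if a = k ∧ b = k then c * c * M l l else 0 := by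
  have hT : (transvection k l c)ᵀ = transvection l k c := by
    simp [transvection, transpose_single]
  have h1 : ∀ a b, (transvection k l c * M) a b = M a b + if a = k then c * M l b else 0 := by
    intro a b
    rw [transvection, add_mul, one_mul, Matrix.add_apply]
    split_ifs with h
    · rw [h, single_mul_apply_same]
    · rw [single_mul_apply_of_ne _ _ _ _ _ h]
  have h2 : ∀ (N : Matrix (Fin 4) (Fin 4) R) (a b), (N * transvection l k c) a b =
      N a b + if b = k then c * N a l else 0 := by
    intro N a b
    rw [transvection, mul_add, mul_one, Matrix.add_apply]
    split_ifs with h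
    · rw [h, mul_single_apply_same, mul_comm c]
    · rw [mul_single_apply_of_ne _ _ _ _ _ h]
  rw [hT, h2, h1, h1]
  split_ifs <;> simp_all
  ring

/-- A comparison of the six coordinates of a vector. The quadratic term in `transvection_conj_apply`
sits on the diagonal, which `vasInv` does not read, so the action is affine in $c$. -/
theorem vasMatrix_eoMat {k l : Fin 4} (h : k ≠ l) (c : R) (p : Hyp R 3) :
    vasMatrix (eoMat (eoIndex k l).1 (eoIndex k l).2 c *ᵥ p) =
      transvection k l c * vasMatrix p * (transvection k l c)ᵀ := by
  rw [← vasMatrix_vasInv (isAlternating_conj (transvection k l c) p)]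
  congr 1
  rw [eoMat_mulVec, vasInv]
  simp only [transvection_conj_apply, vasMatrix_eq_coord]
  ext s
  fin_cases k <;> fin_cases l <;> first | exact absurd rfl h | skip
  all_goals
    rcases s with s | s <;> fin_cases s <;> simp [eoIndex]

theorem coe_specialLinear_mul {n : ℕ} (g g' : SpecialLinearGroup (Fin n) R) :
    ((g * g' : SpecialLinearGroup (Fin n) R) : Matrix (Fin n) (Fin n) R) =
      (g : Matrix (Fin n) (Fin n) R) * (g' : Matrix (Fin n) (Fin n) R) := rfl

theorem coe_specialLinear_mul_inv {n : ℕ} (g : SpecialLinearGroup (Fin n) R) :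
    (g : Matrix (Fin n) (Fin n) R) *
      ((g⁻¹ : SpecialLinearGroup (Fin n) R) : Matrix (Fin n) (Fin n) R) = 1 :=
  congrArg Subtype.val (mul_inv_cancel g)

/-- The matrices `γ` and `t` act compatibly under the Vaserstein map. -/
def VasCompat (γ : GL (Fin 3 ⊕ Fin 3) R) (t : SpecialLinearGroup (Fin 4) R) : Prop :=
  ∀ p : Hyp R 3, vasMatrix ((γ : Matrix (Fin 3 ⊕ Fin 3) (Fin 3 ⊕ Fin 3) R) *ᵥ p) =
    (t : Matrix (Fin 4) (Fin 4) R) * vasMatrix p * (t : Matrix (Fin 4) (Fin 4) R)ᵀ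

theorem VasCompat.one : VasCompat (1 : GL (Fin 3 ⊕ Fin 3) R) 1 := fun p => by simp

theorem VasCompat.mul {γ γ' : GL (Fin 3 ⊕ Fin 3) R} {t t' : SpecialLinearGroup (Fin 4) R}
    (h : VasCompat γ t) (h' : VasCompat γ' t') : VasCompat (γ * γ') (t * t') := fun p => by
  rw [Units.val_mul, ← mulVec_mulVec, h, h', coe_specialLinear_mul, transpose_mul]
  simp only [mul_assoc]

theorem VasCompat.inv {γ : GL (Fin 3 ⊕ Fin 3) R} {t : SpecialLinearGroup (Fin 4) R}
    (h : VasCompat γ t) : VasCompat γ⁻¹ t⁻¹ := fun p => by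
  have h1 : ((t⁻¹ : SpecialLinearGroup (Fin 4) R) : Matrix (Fin 4) (Fin 4) R) *
      (t : Matrix (Fin 4) (Fin 4) R) = 1 := congrArg Subtype.val (inv_mul_cancel t)
  have h2 := h (((γ⁻¹ : GL (Fin 3 ⊕ Fin 3) R) : Matrix (Fin 3 ⊕ Fin 3) (Fin 3 ⊕ Fin 3) R) *ᵥ p)
  rw [mulVec_mulVec, ← Units.val_mul, mul_inv_cancel, Units.val_one, one_mulVec] at h2
  rw [h2, ← mul_assoc, ← mul_assoc, h1, one_mul, mul_assoc, ← transpose_mul, h1, transpose_one,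
    mul_one]

theorem transvection_mem {n : ℕ} {k l : Fin n} (h : k ≠ l) (c : R) :
    (⟨transvection k l c, det_transvection_of_ne k l h c⟩ : SpecialLinearGroup (Fin n) R) ∈
      E R n :=
  Subgroup.subset_closure ⟨k, l, h, c, rfl⟩

theorem exists_vasCompat_of_mem_E {t : SpecialLinearGroup (Fin 4) R} (ht : t ∈ E R 4) :
    ∃ γ ∈ EO R 3, VasCompat γ t := by
  induction ht using Subgroup.closure_induction with
  | mem t ht =>
    obtain ⟨k, l, h, c, hc⟩ := ht
    refine ⟨eoGen (eoIndex_ne h) c, eoGen_mem _ c, fun p => ?_⟩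
    rw [coe_eoGen, vasMatrix_eoMat h, hc]
  | one => exact ⟨1, one_mem _, VasCompat.one⟩
  | mul t t' _ _ h h' =>
    obtain ⟨γ, hγ, h⟩ := h
    obtain ⟨γ', hγ', h'⟩ := h'
    exact ⟨γ * γ', mul_mem hγ hγ', h.mul h'⟩
  | inv t _ h =>
    obtain ⟨γ, hγ, h⟩ := h
    exact ⟨γ⁻¹, inv_mem hγ, h.inv⟩

theorem exists_vasCompat_of_mem_EO {γ : GL (Fin 3 ⊕ Fin 3) R} (hγ : γ ∈ EO R 3) :
    ∃ t ∈ E R 4, VasCompat γ t := by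
  induction hγ using Subgroup.closure_induction with
  | mem γ hγ =>
    obtain ⟨i, j, h, c, hc⟩ := hγ
    have hc : (γ : Matrix (Fin 3 ⊕ Fin 3) (Fin 3 ⊕ Fin 3) R) = eoMat i j c := hc
    rcases exists_eoIndex_eq i j h with rfl | ⟨k, l, hkl, hij | hij⟩
    · have : γ = 1 := Units.ext (hc.trans (eoMat_of_eq_swap i c))
      exact ⟨1, one_mem _, this ▸ VasCompat.one⟩
    · refine ⟨_, transvection_mem hkl c, fun p => ?_⟩
      have := vasMatrix_eoMat hkl c p
      rw [hij] at this
      rw [hc, this]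
    · refine ⟨_, transvection_mem hkl (-c), fun p => ?_⟩
      have := vasMatrix_eoMat hkl (-c) p
      rw [hij, eoMat_swap] at this
      rw [hc, this]
  | one => exact ⟨1, one_mem _, VasCompat.one⟩
  | mul γ γ' _ _ h h' =>
    obtain ⟨t, ht, h⟩ := h
    obtain ⟨t', ht', h'⟩ := h'
    exact ⟨t * t', mul_mem ht ht', h.mul h'⟩
  | inv γ _ h =>
    obtain ⟨t, ht, h⟩ := h
    exact ⟨t⁻¹, inv_mem ht, h.inv⟩

theorem sphereOrbit_EO_iff (p p' : Sphere R 3) :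
    sphereOrbit (EO R 3) p p' ↔ altOrbit (E R 4) (vas p) (vas p') := by
  constructor
  · rintro ⟨γ, hγ, h⟩
    obtain ⟨t, ht, hc⟩ := exists_vasCompat_of_mem_EO hγ
    refine ⟨t, ht, ?_⟩
    change _ * vasMatrix p.1 * _ = vasMatrix p'.1
    rw [← hc, h]
  · rintro ⟨t, ht, h⟩
    obtain ⟨γ, hγ, hc⟩ := exists_vasCompat_of_mem_E ht
    exact ⟨γ, hγ, vasMatrix_injective ((hc p.1).trans h)⟩

theorem spinOrbit_top_iff (p p' : Sphere R 3) :
    spinOrbit (⊤ : Subgroup (Spin R 3)) p p' ↔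
      altOrbit (⊤ : Subgroup (SpecialLinearGroup (Fin 4) R)) (vas p) (vas p') := by
  constructor
  · rintro ⟨x, -, h⟩
    obtain ⟨g, hg⟩ := exists_vasMatrix_spinProj x
    have hM := hg p.1
    rw [h] at hM
    -- Both $V(p)$ and $gV(p)g^{\intercal}$ have Pfaffian $1$, hence $\det g=1$.
    have hdet := pf4_conj g p.1
    rw [← hM, pf4_vasMatrix, p'.2, p.2, mul_one] at hdet
    exact ⟨⟨g, hdet.symm⟩, Subgroup.mem_top _, hM.symm⟩
  · rintro ⟨g, -, h⟩
    obtain ⟨x, hx⟩ := exists_spin_of_specialLinear g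
    exact ⟨x, Subgroup.mem_top _, vasMatrix_injective ((hx p.1).trans h)⟩

/-- Every element of the elementary orthogonal group lifts to the Spin group. -/
theorem exists_spinProj_eq {γ : GL (Fin 3 ⊕ Fin 3) R} (hγ : γ ∈ EO R 3) :
    ∃ x : Spin R 3, spinProj R 3 x = γ := by
  -- The lift passes through $SL_4(R)$: $\gamma$ and $\pi(x)$ both induce $M\mapsto
  -- tMt^{\intercal}$, and $V$ is injective.
  obtain ⟨t, -, hc⟩ := exists_vasCompat_of_mem_EO hγ
  obtain ⟨x, hx⟩ := exists_spin_of_specialLinear t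
  refine ⟨x, Units.ext (Matrix.mulVec_injective (funext fun p => ?_))⟩
  exact vasMatrix_injective ((hx p).trans (hc p).symm)

theorem sphereOrbit_EO_eq_spinOrbit_Epin : sphereOrbit (EO R 3) = spinOrbit (Epin R 3) := by
  ext p p'
  constructor
  · rintro ⟨γ, hγ, h⟩
    obtain ⟨x, rfl⟩ := exists_spinProj_eq hγ
    exact ⟨x, hγ, h⟩
  · rintro ⟨x, hx, h⟩
    exact ⟨_, hx, h⟩

theorem vas_bijective : Function.Bijective (vas (R := R)) := by
  refine ⟨fun p p' h => Subtype.ext (vasMatrix_injective (congrArg Subtype.val h)), fun M => ?_⟩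
  have h := vasMatrix_vasInv M.2.1
  exact ⟨⟨vasInv M.1, by rw [← pf4_vasMatrix, h, M.2.2]⟩, Subtype.ext h⟩

end VasersteinEquivariance

/-! ### Elementary orbits of unimodular rows of length three. -/

section Rows

variable {R : Type*} [CommRing R]

/-- Two rows of length three are equivalent under the elementary linear group. -/
def RowEquiv (v v' : Fin 3 → R) : Prop :=
  ∃ g ∈ E R 3, v ᵥ* (g : Matrix (Fin 3) (Fin 3) R) = v'

theorem RowEquiv.refl (v : Fin 3 → R) : RowEquiv v v := ⟨1, one_mem _, by simp⟩

theorem RowEquiv.symm {v v' : Fin 3 → R} : RowEquiv v v' → RowEquiv v' v := by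
  rintro ⟨g, hg, h⟩
  refine ⟨g⁻¹, inv_mem hg, ?_⟩
  rw [← h, vecMul_vecMul, coe_specialLinear_mul_inv, vecMul_one]

theorem RowEquiv.trans {v v' v'' : Fin 3 → R} :
    RowEquiv v v' → RowEquiv v' v'' → RowEquiv v v'' := by
  rintro ⟨g, hg, h⟩ ⟨g', hg', h'⟩
  exact ⟨g * g', mul_mem hg hg', by rw [← h', ← h, vecMul_vecMul, coe_specialLinear_mul]⟩

theorem vecMul_transvection (v : Fin 3 → R) (i j : Fin 3) (c : R) :
    v ᵥ* transvection i j c = v + Pi.single j (c * v i) := by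
  rw [transvection, vecMul_add, vecMul_one]
  congr 1
  ext k
  by_cases hk : k = j
  · subst hk
    simp [vecMul, dotProduct, single_apply, mul_comm]
  · simp [vecMul, dotProduct, hk, Ne.symm hk]

theorem rowEquiv_of_apply {i j : Fin 3} (h : i ≠ j) (c : R) {v v' : Fin 3 → R}
    (hj : v' j = v j + c * v i) (hv : ∀ k, k ≠ j → v' k = v k) : RowEquiv v v' := by
  refine ⟨_, transvection_mem h c, ?_⟩
  rw [vecMul_transvection]
  ext k
  by_cases hk : k = j
  · subst hk
    simp [hj]
  · simp [hk, hv k hk]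

/-- Adding a Koszul vector of `w` to a row `v` with `v ⬝ w = 1` does not change its class under
the elementary linear group. -/
theorem rowEquiv_add_koszul {v w : Fin 3 → R} (hvw : v ⬝ᵥ w = 1) {a b : Fin 3} (hab : a ≠ b)
    (c : R) : RowEquiv v (v + Pi.single a (c * w b) - Pi.single b (c * w a)) := by
  obtain ⟨k, hka, hkb, hk⟩ : ∃ k, k ≠ a ∧ k ≠ b ∧ ∀ m, m = a ∨ m = b ∨ m = k := by
    revert a b
    decide
  have hsum : v a * w a + v b * w b + v k * w k = 1 := by
    rw [← hvw, dotProduct]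
    have : (Finset.univ : Finset (Fin 3)) = {a, b, k} := by
      ext m
      simpa using hk m
    rw [this, Finset.sum_insert (by simp [hab, hka.symm]), Finset.sum_insert (by simp [hkb.symm]),
      Finset.sum_singleton, add_assoc]
  let r : R → R → R → Fin 3 → R := fun x y z m => if m = a then x else if m = b then y else z
  have ra : ∀ x y z, r x y z a = x := fun x y z => if_pos rfl
  have rb : ∀ x y z, r x y z b = y := fun x y z => (if_neg hab.symm).trans (if_pos rfl)
  have rk : ∀ x y z, r x y z k = z := fun x y z => (if_neg hka).trans (if_neg hkb)
  have r_ext : ∀ u : Fin 3 → R, u = r (u a) (u b) (u k) := by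
    intro u
    ext m
    rcases hk m with rfl | rfl | rfl
    · rw [ra]
    · rw [rb]
    · rw [rk]
  have add_a : ∀ x y z d, RowEquiv (r x y z) (r (x + d * z) y z) := fun x y z d =>
    rowEquiv_of_apply hka d (by rw [ra, ra, rk]) fun m hm => by
      rcases hk m with rfl | rfl | rfl
      · exact absurd rfl hm
      · rw [rb, rb]
      · rw [rk, rk]
  have add_b : ∀ x y z d, RowEquiv (r x y z) (r x (y + d * z) z) := fun x y z d =>
    rowEquiv_of_apply hkb d (by rw [rb, rb, rk]) fun m hm => by
      rcases hk m with rfl | rfl | rfl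
      · rw [ra, ra]
      · exact absurd rfl hm
      · rw [rk, rk]
  have add_k : ∀ x y z d e, RowEquiv (r x y z) (r x y (z + d * x + e * y)) := fun x y z d e =>
    (rowEquiv_of_apply (v' := r x y (z + d * x)) hka.symm d (by rw [rk, rk, ra]) fun m hm => by
      rcases hk m with rfl | rfl | rfl
      · rw [ra, ra]
      · rw [rb, rb]
      · exact absurd rfl hm).trans
    (rowEquiv_of_apply hkb.symm e (by rw [rk, rk, rb]) fun m hm => by
      rcases hk m with rfl | rfl | rfl
      · rw [ra, ra]
      · rw [rb, rb]
      · exact absurd rfl hm)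
  -- The coordinate $z=v_k+w_av_a+w_bv_b$ equals $1+(1-w_k)v_k$. Adding $cw_bz$ and $-cw_az$ at $a$
  -- and $b$ leaves $w_av_a+w_bv_b$ unchanged, so $z$ can afterwards be restored to $v_k$.
  have h1 := add_k (v a) (v b) (v k) (w a) (w b)
  set z := v k + w a * v a + w b * v b with hz
  have h2 := (h1.trans (add_a _ _ _ (c * w b))).trans (add_b _ _ _ (-(c * w a)))
  have h3 := h2.trans (add_k _ _ _ (-w a) (-w b))
  have hz' : z + -w a * (v a + c * w b * z) + -w b * (v b + -(c * w a) * z) = v k := by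
    rw [hz]
    ring
  rw [hz'] at h3
  -- What exceeds the Koszul vector is $cw_b(1-w_k)v_k$ at $a$ and $-cw_a(1-w_k)v_k$ at $b$,
  -- multiples of $v_k$ that are now subtracted.
  have h4 := (h3.trans (add_a _ _ _ (c * w k * w b - c * w b))).trans
    (add_b _ _ _ (c * w a - c * w k * w a))
  rw [← r_ext] at h4
  convert h4 using 1
  refine (r_ext _).trans ?_
  congr 1
  · simp only [Pi.add_apply, Pi.sub_apply, Pi.single_eq_same, Pi.single_eq_of_ne hab, hz]
    linear_combination (-(c * w b)) * hsum
  · simp only [Pi.add_apply, Pi.sub_apply, Pi.single_eq_same, Pi.single_eq_of_ne hab.symm, hz]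
    linear_combination (c * w a) * hsum
  · simp only [Pi.add_apply, Pi.sub_apply, Pi.single_eq_of_ne hka, Pi.single_eq_of_ne hkb]
    ring

/-- Generators with both indices on the same side act on $v$ by an elementary operation, those from
$v$ to $w$ fix $v$, and those from $w$ to $v$ add a Koszul vector of $w$. Only the last kind needs
$q(p)=1$. -/
theorem rowEquiv_eoMat {i j : Fin 3 ⊕ Fin 3} (h : i ≠ j) (c : R) {p : Hyp R 3}
    (hp : hypQ R 3 p = 1) :
    RowEquiv (fun k => p (Sum.inl k)) (fun k => (eoMat i j c *ᵥ p) (Sum.inl k)) := by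
  rw [eoMat_mulVec]
  rcases i with i | i <;> rcases j with j | j
  · have hij : j ≠ i := fun e => h (e ▸ rfl)
    refine rowEquiv_of_apply hij c (by simp) fun k hk => ?_
    simp [hk]
  · by_cases hij : i = j
    · subst hij
      simpa using RowEquiv.refl _
    · convert rowEquiv_add_koszul (v := fun k => p (Sum.inl k)) (w := fun k => p (Sum.inr k)) hp
        hij c using 1
      ext k
      simp [Pi.single_apply, mul_sub]
      ring
  · simpa using RowEquiv.refl _
  · have hij : i ≠ j := fun e => h (e ▸ rfl)
    refine rowEquiv_of_apply hij (-c) (by simp) fun k hk => ?_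
    simp [hk]

theorem hypQ_and_rowEquiv_of_mem_EO {γ : GL (Fin 3 ⊕ Fin 3) R} (hγ : γ ∈ EO R 3) :
    ∀ p : Hyp R 3,
      hypQ R 3 ((γ : Matrix (Fin 3 ⊕ Fin 3) (Fin 3 ⊕ Fin 3) R) *ᵥ p) = hypQ R 3 p ∧
      (hypQ R 3 p = 1 → RowEquiv (fun k => p (Sum.inl k))
        (fun k => ((γ : Matrix (Fin 3 ⊕ Fin 3) (Fin 3 ⊕ Fin 3) R) *ᵥ p) (Sum.inl k))) := by
  induction hγ using Subgroup.closure_induction with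
  | mem γ hγ =>
    obtain ⟨i, j, h, c, hc⟩ := hγ
    have hc : (γ : Matrix (Fin 3 ⊕ Fin 3) (Fin 3 ⊕ Fin 3) R) = eoMat i j c := hc
    intro p
    rw [hc]
    exact ⟨hypQ_eoMat_mulVec h c p, rowEquiv_eoMat h c⟩
  | one => exact fun p => by simpa using fun _ => RowEquiv.refl _
  | mul γ γ' _ _ h h' =>
    intro p
    rw [Units.val_mul, ← mulVec_mulVec]
    exact ⟨(h _).1.trans (h' p).1,
      fun hp => ((h' p).2 hp).trans ((h _).2 ((h' p).1.trans hp))⟩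
  | inv γ _ h =>
    intro p
    have h1 := h (((γ⁻¹ : GL (Fin 3 ⊕ Fin 3) R) : Matrix (Fin 3 ⊕ Fin 3) (Fin 3 ⊕ Fin 3) R) *ᵥ p)
    rw [mulVec_mulVec, ← Units.val_mul, mul_inv_cancel, Units.val_one, one_mulVec] at h1
    exact ⟨h1.1.symm, fun hp => (h1.2 (h1.1.symm.trans hp)).symm⟩

theorem exists_mem_EO_of_mem_E {g : SpecialLinearGroup (Fin 3) R} (hg : g ∈ E R 3) :
    ∃ γ ∈ EO R 3, ∀ p : Hyp R 3,
      (fun k => ((γ : Matrix (Fin 3 ⊕ Fin 3) (Fin 3 ⊕ Fin 3) R) *ᵥ p) (Sum.inl k)) =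
        (fun k => p (Sum.inl k)) ᵥ* (g : Matrix (Fin 3) (Fin 3) R) := by
  induction hg using Subgroup.closure_induction with
  | mem g hg =>
    obtain ⟨i, j, h, c, hc⟩ := hg
    have hji : (Sum.inl j : Fin 3 ⊕ Fin 3) ≠ Sum.inl i := fun e => h (Sum.inl_injective e).symm
    refine ⟨eoGen hji c, eoGen_mem _ c, fun p => ?_⟩
    rw [coe_eoGen, eoMat_mulVec, hc, vecMul_transvection]
    ext k
    simp [Pi.single_apply]
  | one => exact ⟨1, one_mem _, fun p => by simp⟩
  | mul g g' _ _ h h' =>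
    obtain ⟨γ, hγ, h⟩ := h
    obtain ⟨γ', hγ', h'⟩ := h'
    -- The order is reversed because rows are acted on from the right and $H(R^3)$ from the left.
    refine ⟨γ' * γ, mul_mem hγ' hγ, fun p => ?_⟩
    rw [Units.val_mul, ← mulVec_mulVec, h', h, vecMul_vecMul, coe_specialLinear_mul]
  | inv g _ h =>
    obtain ⟨γ, hγ, h⟩ := h
    refine ⟨γ⁻¹, inv_mem hγ, fun p => ?_⟩
    have h1 := h (((γ⁻¹ : GL (Fin 3 ⊕ Fin 3) R) : Matrix (Fin 3 ⊕ Fin 3) (Fin 3 ⊕ Fin 3) R) *ᵥ p)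
    rw [mulVec_mulVec, ← Units.val_mul, mul_inv_cancel, Units.val_one, one_mulVec] at h1
    rw [h1, vecMul_vecMul, coe_specialLinear_mul_inv, vecMul_one]

/-- Two points `(v, w)` and `(v, w')` of the unit sphere are equivalent under `EO_6(R)`. -/
theorem exists_mem_EO_of_inl_eq {p p' : Hyp R 3} (hp : hypQ R 3 p = 1) (hp' : hypQ R 3 p' = 1)
    (h : ∀ k, p (Sum.inl k) = p' (Sum.inl k)) :
    ∃ γ ∈ EO R 3, (γ : Matrix (Fin 3 ⊕ Fin 3) (Fin 3 ⊕ Fin 3) R) *ᵥ p = p' := by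
  have hne : ∀ a b : Fin 3, (Sum.inr a : Fin 3 ⊕ Fin 3) ≠ Sum.inl b := fun a b => by simp
  -- From $v\cdot w=v\cdot w'=1$ it follows that $w'_a-w_a=\sum_b(w'_aw_b-w'_bw_a)v_b$. The three
  -- generators fix $v$, so their changes to $w$ add up to this sum.
  let d : Fin 3 → Fin 3 → R := fun a b =>
    p' (Sum.inr a) * p (Sum.inr b) - p' (Sum.inr b) * p (Sum.inr a)
  refine ⟨eoGen (hne 0 1) (d 0 1) * eoGen (hne 0 2) (d 0 2) * eoGen (hne 1 2) (d 1 2),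
    mul_mem (mul_mem (eoGen_mem _ _) (eoGen_mem _ _)) (eoGen_mem _ _), ?_⟩
  rw [Units.val_mul, Units.val_mul, ← mulVec_mulVec, ← mulVec_mulVec, coe_eoGen, coe_eoGen,
    coe_eoGen]
  simp only [eoMat_mulVec]
  rw [hypQ_three] at hp hp'
  simp only [← h] at hp'
  ext s
  rcases s with s | s
  · rw [← h]
    simp
  · fin_cases s
    · simp [d]
      linear_combination p' (Sum.inr 0) * hp - p (Sum.inr 0) * hp'
    · simp [d]
      linear_combination p' (Sum.inr 1) * hp - p (Sum.inr 1) * hp'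
    · simp [d]
      linear_combination p' (Sum.inr 2) * hp - p (Sum.inr 2) * hp'

theorem sphereOrbit_EO_iff_row (p p' : Sphere R 3) :
    sphereOrbit (EO R 3) p p' ↔ umOrbit (E R 3) p.row p'.row := by
  constructor
  · rintro ⟨γ, hγ, h⟩
    have := (hypQ_and_rowEquiv_of_mem_EO hγ p.1).2 p.2
    rwa [h] at this
  · rintro ⟨g, hg, h⟩
    obtain ⟨γ, hγ, hr⟩ := exists_mem_EO_of_mem_E hg
    obtain ⟨γ', hγ', h'⟩ := exists_mem_EO_of_inl_eq
      (((hypQ_and_rowEquiv_of_mem_EO hγ p.1).1).trans p.2) p'.2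
      (fun k => congrFun ((hr p.1).trans h) k)
    exact ⟨γ' * γ, mul_mem hγ' hγ, by rw [Units.val_mul, ← mulVec_mulVec, h']⟩

theorem row_surjective : Function.Surjective (Sphere.row (R := R) (n := 3)) := by
  rintro ⟨v, w, h⟩
  exact ⟨⟨Sum.elim v w, h⟩, rfl⟩

end Rows

/-- A surjection under which two equivalence relations correspond induces a bijection of the
quotients. -/
theorem exists_quotient_equiv {α β : Type*} (s : Setoid α) (t : Setoid β) {f : α → β}
    (hf : Function.Surjective f) (h : ∀ a b, s a b ↔ t (f a) (f b)) :
    ∃ F : Quotient s ≃ Quotient t, ∀ a, F (Quotient.mk _ a) = Quotient.mk _ (f a) := by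
  refine ⟨Equiv.ofBijective (Quotient.map f fun a b => (h a b).1) ⟨?_, ?_⟩, fun a => rfl⟩
  · rintro ⟨a⟩ ⟨b⟩ hab
    exact Quotient.sound ((h a b).2 (Quotient.exact hab))
  · rintro ⟨b⟩
    obtain ⟨a, rfl⟩ := hf b
    exact ⟨Quotient.mk _ a, rfl⟩

end SpinVas

theorem theorem6p1 (R : Type*) [CommRing R] :
    (∃ F : Quotient (SpinVas.spinOrbit (⊤ : Subgroup (SpinVas.Spin R 3))) ≃
        Quotient (SpinVas.altOrbit (⊤ : Subgroup (Matrix.SpecialLinearGroup (Fin 4) R))),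
      ∀ p : SpinVas.Sphere R 3, F (Quotient.mk _ p) = Quotient.mk _ (SpinVas.vas p)) ∧
    SpinVas.sphereOrbit (SpinVas.EO R 3) = SpinVas.spinOrbit (SpinVas.Epin R 3) ∧
    (∃ f : Quotient (SpinVas.umOrbit (SpinVas.E R 3)) ≃
        Quotient (SpinVas.sphereOrbit (SpinVas.EO R 3)),
      ∀ p : SpinVas.Sphere R 3, f (Quotient.mk _ p.row) = Quotient.mk _ p) ∧
    (∃ g : Quotient (SpinVas.umOrbit (SpinVas.E R 3)) ≃
        Quotient (SpinVas.spinOrbit (SpinVas.Epin R 3)),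
      ∀ p : SpinVas.Sphere R 3, g (Quotient.mk _ p.row) = Quotient.mk _ p) ∧
    (∃ h : Quotient (SpinVas.spinOrbit (SpinVas.Epin R 3)) ≃
        Quotient (SpinVas.altOrbit (SpinVas.E R 4)),
      ∀ p : SpinVas.Sphere R 3, h (Quotient.mk _ p) = Quotient.mk _ (SpinVas.vas p)) := by
  have hrow : ∃ f : Quotient (SpinVas.umOrbit (SpinVas.E R 3)) ≃
        Quotient (SpinVas.sphereOrbit (SpinVas.EO R 3)),
      ∀ p : SpinVas.Sphere R 3, f (Quotient.mk _ p.row) = Quotient.mk _ p := by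
    obtain ⟨F, hF⟩ := SpinVas.exists_quotient_equiv _ _ SpinVas.row_surjective
      (SpinVas.sphereOrbit_EO_iff_row (R := R))
    exact ⟨F.symm, fun p => by rw [← hF, Equiv.symm_apply_apply]⟩
  refine ⟨SpinVas.exists_quotient_equiv _ _ SpinVas.vas_bijective.2 SpinVas.spinOrbit_top_iff,
    SpinVas.sphereOrbit_EO_eq_spinOrbit_Epin, hrow, ?_, ?_⟩
  · rwa [SpinVas.sphereOrbit_EO_eq_spinOrbit_Epin] at hrow
  · rw [← SpinVas.sphereOrbit_EO_eq_spinOrbit_Epin]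
    exact SpinVas.exists_quotient_equiv _ _ SpinVas.vas_bijective.2 SpinVas.sphereOrbit_EO_iff
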